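/- Definitions. A set $S$ of vertices of a graph is an identifying code if the sets $N[v]\cap S$ ($v$ a vertex, $N[v]$ its closed neighbourhood) are non-empty and pairwise distinct. A generalized quadrangle $\mathrm{GQ}(s,t)$ (with $s,t\ge 1$) is a non-empty incidence structure of points and lines in which two distinct points lie on at most one common line, every line has $s+1$ points, every point is on $t+1$ lines, and for every point $P$ not on a line $L$ there is exactly one line through $P$ meeting $L$. Its adjacency graph has the points as vertices, two distinct points being adjacent if they lie on a common line; an identifying code of the quadrangle means one of this graph. Proposition. For every prime power $q$ there is a $\mathrm{GQ}(q,q^2)$ with an identifying code of size $5q=\Theta(n^{1/4})$, where $n$ is the number of points and the implied constants are absolute. More precisely, let $F$ be any field of order $q$. There is $d\in F$ such that $dX_0^2+X_0X_1+X_1^2$ is irreducible over $F$. For every such $d$ let $Q^-(5,q)$ be the incidence structure of the points and the lines of $\mathrm{PG}(5,q)$ contained in the elliptic quadric $$dX_0^2+X_0X_1+X_1^2+X_2X_3+X_4X_5=0 .$$ It is a $\mathrm{GQ}(q,q^2)$, and $5q=\Theta(n^{1/4})$ with the same absolute constants, $n$ being its number of points. Moreover: (a) For every line $\ell_0$ of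 $Q^-(5,q)$ there are two 3-spaces $\pi_1,\pi_2$ of $\mathrm{PG}(5,q)$ with $\pi_1\cap\pi_2=\ell_0$, each meeting the quadric in a hyperbolic quadric $Q^+(3,q)$ (that is, the form restricted to the 3-space is $Y_0Y_1+Y_2Y_3$ in suitable coordinates). (b) For all such $\ell_0,\pi_1,\pi_2$ there are lines $\ell_1,\ell_2\subset\pi_1$ and $\ell_3,\ell_4\subset\pi_2$ of $Q^-(5,q)$ such that $\ell_0,\ell_1,\ell_2$ are pairwise disjoint and $\ell_0,\ell_3,\ell_4$ are pairwise disjoint. (c) For all such $\ell_0,\dots,\ell_4$, the set $\ell_0\cup\dots\cup\ell_4$ is an identifying code with $5q+5$ points; and for every point $x\in\ell_0$, deleting from it $x$ and the points of $\ell_1,\dots,\ell_4$ adjacent to $x$ leaves an identifying code with exactly $5q$ points. -/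

import Mathlib

open scoped LinearAlgebra.Projectivization

/-! ### Identifying codes in graphs -/

/-- The closed neighbourhood `N[v]` of a vertex `v`. -/
def SimpleGraph.closedNbhd {V : Type*} (G : SimpleGraph V) (v : V) : Set V :=
  insert v (G.neighborSet v)

/-- `S` is dominating if it meets every closed neighbourhood. -/
def SimpleGraph.IsDominatingSet {V : Type*} (G : SimpleGraph V) (S : Set V) : Prop :=
  ∀ v, (S ∩ G.closedNbhd v).Nonempty

/-- `c` separates `u` and `v` if it lies in exactly one of their closed neighbourhoods. -/
def SimpleGraph.Separates {V : Type*} (G : SimpleGraph V) (c u v : V) : Prop :=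
  c ∈ symmDiff (G.closedNbhd u) (G.closedNbhd v)

/-- `S` is separating if any two distinct vertices are separated by a vertex of `S`. -/
def SimpleGraph.IsSeparatingSet {V : Type*} (G : SimpleGraph V) (S : Set V) : Prop :=
  ∀ u v, u ≠ v → ∃ c ∈ S, G.Separates c u v

/-- An identifying code is a set of vertices that is both dominating and separating. -/
def SimpleGraph.IsIdentifyingCode {V : Type*} (G : SimpleGraph V) (S : Set V) : Prop :=
  G.IsDominatingSet S ∧ G.IsSeparatingSet S

/-! ### Generalized quadrangles -/

/-- The incidence structure with points `P`, lines `L` and incidence relation `I` is a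
generalized quadrangle `GQ(s,t)`. -/
structure IsGeneralizedQuadrangle {P L : Type*} (I : P → L → Prop) (s t : ℕ) : Prop where
  pos_left : 0 < s
  pos_right : 0 < t
  nonempty : Nonempty P
  /-- two distinct points lie on at most one common line -/
  line_unique : ∀ x y : P, x ≠ y → ∀ l m : L, I x l → I y l → I x m → I y m → l = m
  /-- every line has `s + 1` points -/
  card_points : ∀ l : L, {x : P | I x l}.ncard = s + 1
  /-- every point is on `t + 1` lines -/
  card_lines : ∀ x : P, {l : L | I x l}.ncard = t + 1
  /-- a point off a line is on exactly one line meeting that line -/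
  projection : ∀ (x : P) (l : L), ¬ I x l → ∃! m : L, I x m ∧ ∃ y : P, I y m ∧ I y l

/-- The adjacency graph of an incidence structure: two distinct points are adjacent
if they are on a common line. -/
def adjacencyGraph {P L : Type*} (I : P → L → Prop) : SimpleGraph P where
  Adj x y := x ≠ y ∧ ∃ l, I x l ∧ I y l
  symm := ⟨fun _ _ h => ⟨h.1.symm, h.2.imp fun _ hl => ⟨hl.2, hl.1⟩⟩⟩
  loopless := ⟨fun _ h => h.1 rfl⟩

/-! ### Quadrics in projective spaces -/

/-- The point set of the quadric `Q = 0`. -/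
def quadric {F V : Type*} [Field F] [AddCommGroup V] [Module F V] (Q : QuadraticForm F V) :
    Set (ℙ F V) :=
  {p | Q p.rep = 0}

theorem mk_mem_quadric {F V : Type*} [Field F] [AddCommGroup V] [Module F V]
    (Q : QuadraticForm F V) (v : V) (hv : v ≠ 0) :
    Projectivization.mk F v hv ∈ quadric Q ↔ Q v = 0 := by
  obtain ⟨a, ha⟩ := Projectivization.exists_smul_eq_mk_rep F v hv
  simp [quadric, ← ha, Units.smul_def, QuadraticMap.map_smul]

/-- A projective subspace has projective dimension `k` if the corresponding linear subspace has
dimension `k + 1`. -/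
def HasProjDim {F V : Type*} [Field F] [AddCommGroup V] [Module F V]
    (W : Projectivization.Subspace F V) (k : ℕ) : Prop :=
  Module.finrank F (Projectivization.Subspace.submodule W) = k + 1

/-- The form `X₀X₁ + X₂X₃`, which defines the hyperbolic quadric `Q⁺(3,q)`. -/
def hyperbolicForm (F : Type*) [Field F] : QuadraticForm F (Fin 4 → F) :=
  QuadraticMap.proj 0 1 + QuadraticMap.proj 2 3

/-- The projective subspace `W` cuts the quadric `Q = 0` in a hyperbolic quadric `Q⁺(3,q)`:
in suitable coordinates of `W`, the restriction of `Q` is `X₀X₁ + X₂X₃`. In particular `W` is a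
3-space. -/
def MeetsInHyperbolicQuadric {F V : Type*} [Field F] [AddCommGroup V] [Module F V]
    (Q : QuadraticForm F V) (W : Projectivization.Subspace F V) : Prop :=
  (Q.comp (Projectivization.Subspace.submodule W).subtype).Equivalent (hyperbolicForm F)

/-! ### The elliptic quadric -/

/-- The binary form `d X₀² + X₀X₁ + X₁²` is irreducible over `F`. -/
def IrreducibleBinaryForm {F : Type*} [Field F] (d : F) : Prop :=
  Irreducible (MvPolynomial.C d * MvPolynomial.X 0 ^ 2 + MvPolynomial.X 0 * MvPolynomial.X 1
    + MvPolynomial.X 1 ^ 2 : MvPolynomial (Fin 2) F)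

/-- The form `(d X₀² + X₀X₁ + X₁²) + X₂X₃ + X₄X₅`. -/
def ellipticForm {F : Type*} [Field F] (d : F) : QuadraticForm F (Fin 6 → F) :=
  d • QuadraticMap.proj 0 0 + QuadraticMap.proj 0 1 + QuadraticMap.proj 1 1
    + QuadraticMap.proj 2 3 + QuadraticMap.proj 4 5

theorem ellipticForm_apply {F : Type*} [Field F] (d : F) (x : Fin 6 → F) :
    ellipticForm d x
      = (d * x 0 ^ 2 + x 0 * x 1 + x 1 ^ 2) + x 2 * x 3 + x 4 * x 5 := by
  simp [ellipticForm, pow_two]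

namespace EllipticQuadric

/-- The points of `Q⁻(5,q)`. -/
abbrev Point {F : Type*} [Field F] (d : F) : Type _ :=
  {p : ℙ F (Fin 6 → F) // p ∈ quadric (ellipticForm d)}

/-- The lines of `Q⁻(5,q)`: the lines of `PG(5,q)` contained in the quadric. -/
abbrev Line {F : Type*} [Field F] (d : F) : Type _ :=
  {l : Projectivization.Subspace F (Fin 6 → F) //
    HasProjDim l 1 ∧ (l : Set (ℙ F (Fin 6 → F))) ⊆ quadric (ellipticForm d)}

/-- Incidence in `Q⁻(5,q)`. -/
def Inc {F : Type*} [Field F] (d : F) (p : Point d) (l : Line d) : Prop :=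
  p.1 ∈ l.1

/-- `π₁` and `π₂` are 3-spaces that meet exactly in the line `l₀` and that both cut the elliptic
quadric in a `Q⁺(3,q)`. -/
structure IsSolidPair {F : Type*} [Field F] (d : F) (l₀ : Line d)
    (π₁ π₂ : Projectivization.Subspace F (Fin 6 → F)) : Prop where
  dim_left : HasProjDim π₁ 3
  dim_right : HasProjDim π₂ 3
  inf_eq : π₁ ⊓ π₂ = l₀.1
  hyperbolic_left : MeetsInHyperbolicQuadric (ellipticForm d) π₁
  hyperbolic_right : MeetsInHyperbolicQuadric (ellipticForm d) π₂

/-- `l 1, l 2` are lines of the quadric in `π₁`, and `l 3, l 4` lines of the quadric in `π₂`, such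
that `l 0, l 1, l 2` as well as `l 0, l 3, l 4` are pairwise non-intersecting. -/
structure IsFiveLines {F : Type*} [Field F] (d : F)
    (π₁ π₂ : Projectivization.Subspace F (Fin 6 → F)) (l : Fin 5 → Line d) : Prop where
  solids : IsSolidPair d (l 0) π₁ π₂
  le₁ : (l 1).1 ≤ π₁
  le₂ : (l 2).1 ≤ π₁
  le₃ : (l 3).1 ≤ π₂
  le₄ : (l 4).1 ≤ π₂
  inf₀₁ : (l 0).1 ⊓ (l 1).1 = ⊥
  inf₀₂ : (l 0).1 ⊓ (l 2).1 = ⊥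
  inf₁₂ : (l 1).1 ⊓ (l 2).1 = ⊥
  inf₀₃ : (l 0).1 ⊓ (l 3).1 = ⊥
  inf₀₄ : (l 0).1 ⊓ (l 4).1 = ⊥
  inf₃₄ : (l 3).1 ⊓ (l 4).1 = ⊥

/-- All points on the five lines. -/
def linePoints {F : Type*} [Field F] {d : F} (l : Fin 5 → Line d) : Set (Point d) :=
  {p | ∃ i, Inc d p (l i)}

/-- The point `x` (on `l 0`) and its projections on the lines `l 1, …, l 4`, that is, the points
of these lines that are adjacent to `x`. -/
def removedPoints {F : Type*} [Field F] {d : F} (l : Fin 5 → Line d) (x : Point d) :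
    Set (Point d) :=
  {p | p = x ∨ ∃ i, i ≠ 0 ∧ Inc d p (l i) ∧ (adjacencyGraph (Inc d)).Adj x p}

end EllipticQuadric

/-! ### The binary form `d X₀² + X₀X₁ + X₁²` -/

section BinaryForm

variable {F : Type*} [Field F] {d : F}

/-! The proof turns the geometry into linear algebra. Two points of the quadric are equal or
collinear exactly when their vectors are orthogonal for the polar form, so the closed neighbourhood
of `u` is the set of points orthogonal to `u`. Anisotropy of the binary form makes totally singular
subspaces at most two-dimensional. Hence a point orthogonal to two points of a line of the quadric
lies on that line, and a point off a line has exactly one neighbour on it, its projection. The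
parameters `q` and `q²` come from counting singular vectors.

The core is `IsFiveLines.eq_of_forall_perp`: a point `u` off `l 0` is determined by its projections
`y 0, …, y 4`. Suppose `v ≠ u` is orthogonal to all of them, and let `O` be the orthogonal
complement of `u` and `v`, of dimension 4. The points `y 0, y 1, y 2` are pairwise non-orthogonal,
so they span a 3-dimensional space in `O` and `π₁`; likewise `y 0, y 3, y 4` span one in `O` and
`π₂`. Inside `O` these two meet in dimension at least 2, and they meet within `π₁ ⊓ π₂ = l 0`. So `l
0` lies in `O`, and `u` is orthogonal to `l 0`, hence on it: a contradiction.

Deleting `x` and its projections removes one point `y i` from each line. Little is lost: if the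
projection of `u` on `l i` is the deleted point and that of `v` is not, then the latter is in the
code and separates them. So unseparated points off the lines still have equal projections. -/

theorem IrreducibleBinaryForm.anisotropic (hd : IrreducibleBinaryForm d) {a b : F}
    (h : d * a ^ 2 + a * b + b ^ 2 = 0) : a = 0 ∧ b = 0 := by
  rcases eq_or_ne a 0 with rfl | ha
  · simpa using h
  exfalso
  obtain ⟨t, rfl⟩ : ∃ t, b = t * a := ⟨b / a, by field_simp⟩
  have hdt : d = -(t * (1 + t)) := by
    have : a ^ 2 * (d + t * (1 + t)) = 0 := by linear_combination h
    have := (mul_eq_zero.1 this).resolve_left (pow_ne_zero 2 ha)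
    linear_combination this
  -- The zero `(a, t * a)` yields the factor `X₁ - t X₀`; the cofactor is forced. Both factors
  -- vanish at the origin, so neither is a unit.
  have key : (MvPolynomial.C d * MvPolynomial.X 0 ^ 2 + MvPolynomial.X 0 * MvPolynomial.X 1
      + MvPolynomial.X 1 ^ 2 : MvPolynomial (Fin 2) F) =
      (MvPolynomial.X 1 - MvPolynomial.C t * MvPolynomial.X 0) *
      (MvPolynomial.X 1 + MvPolynomial.C (1 + t) * MvPolynomial.X 0) := by
    simp only [hdt, map_neg, map_mul, map_add, map_one]
    ring
  have hnu : ∀ p : MvPolynomial (Fin 2) F, MvPolynomial.eval (fun _ => 0) p = 0 → ¬ IsUnit p :=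
    fun p hp hu => not_isUnit_zero (hp ▸ hu.map (MvPolynomial.eval (fun _ => (0 : F))))
  rcases hd.isUnit_or_isUnit key with h | h
  · exact hnu _ (by simp) h
  · exact hnu _ (by simp) h

/-- As a polynomial in `X₀` over `F[y]`, the form is a unit times a monic quadratic, so it can only
factor if it has a root in `F[y]`. -/
theorem irreducibleBinaryForm_of_forall_ne (h : ∀ r : F, d * r ^ 2 + r + 1 ≠ 0) :
    IrreducibleBinaryForm d := by
  have hd0 : d ≠ 0 := by
    rintro rfl
    exact h (-1) (by ring)
  unfold IrreducibleBinaryForm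
  rw [← MulEquiv.irreducible_iff (MvPolynomial.finSuccEquiv F 1)]
  set y : MvPolynomial (Fin 1) F := MvPolynomial.X 0
  have h1 : (MvPolynomial.X 1 : MvPolynomial (Fin 2) F) = MvPolynomial.X (Fin.succ 0) := rfl
  have hC : ∀ c : F, MvPolynomial.finSuccEquiv F 1 (MvPolynomial.C c)
      = Polynomial.C (MvPolynomial.C c) := fun c => by
    rw [← AlgEquiv.eq_symm_apply]
    simpa using (congrArg (fun g => g c) (MvPolynomial.finSuccEquiv_comp_C_eq_C (R := F) 1)).symm
  let p : Polynomial (MvPolynomial (Fin 1) F) := Polynomial.X ^ 2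
    + Polynomial.C (MvPolynomial.C d⁻¹ * y) * Polynomial.X
    + Polynomial.C (MvPolynomial.C d⁻¹ * y ^ 2)
  have hdd : (MvPolynomial.C d * MvPolynomial.C d⁻¹ : MvPolynomial (Fin 1) F) = 1 := by
    rw [← map_mul, mul_inv_cancel₀ hd0, map_one]
  have heq : MvPolynomial.finSuccEquiv F 1 (MvPolynomial.C d * MvPolynomial.X 0 ^ 2
      + MvPolynomial.X 0 * MvPolynomial.X 1 + MvPolynomial.X 1 ^ 2) =
      Polynomial.C (MvPolynomial.C d) * p := by
    simp only [h1, map_add, map_mul, map_pow, MvPolynomial.finSuccEquiv_X_zero,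
      MvPolynomial.finSuccEquiv_X_succ, hC, p]
    have hdd' : (Polynomial.C (MvPolynomial.C d) * Polynomial.C (MvPolynomial.C d⁻¹) :
      Polynomial (MvPolynomial (Fin 1) F)) = 1 := by rw [← map_mul, hdd, map_one]
    linear_combination (-(Polynomial.C y * Polynomial.X) - Polynomial.C y ^ 2) * hdd'
  have hu : IsUnit (Polynomial.C (MvPolynomial.C d) : Polynomial (MvPolynomial (Fin 1) F)) :=
    ((Ne.isUnit hd0).map MvPolynomial.C).map Polynomial.C
  rw [heq, irreducible_isUnit_mul hu]
  have hdeg : p.natDegree = 2 := by simp only [p]; compute_degree!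
  have hmon : p.Monic := by simp only [p]; monicity!
  rw [hmon.irreducible_iff_roots_eq_zero_of_degree_le_three (by omega) (by omega)]
  refine Multiset.eq_zero_of_forall_notMem fun r hr => ?_
  have hr := Polynomial.isRoot_of_mem_roots hr
  -- Setting `y = 1` turns a root in `F[y]` into an element `r` of `F` with `d r² + r + 1 = 0`.
  have h2 := congrArg (MvPolynomial.eval fun _ => (1 : F)) hr
  simp [p, y] at h2
  apply h (MvPolynomial.eval (fun _ => (1 : F)) r)
  field_simp at h2
  linear_combination h2

theorem exists_irreducibleBinaryForm (F : Type*) [Field F] [Finite F] :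
    ∃ d : F, IrreducibleBinaryForm d := by
  -- The map `t ↦ t² + t` takes the value 0 at both 0 and -1, so on a finite field it also misses a
  -- value `e`; a root `r` for `d = -e` would give `e = r⁻² + r⁻¹`. This treats all characteristics
  -- alike.
  have hns : ¬ Function.Surjective fun t : F => t ^ 2 + t := fun hs => by
    have := Finite.injective_iff_surjective.2 hs (a₁ := 0) (a₂ := -1) (by simp)
    simp at this
  simp only [Function.Surjective, not_forall, not_exists] at hns
  obtain ⟨e, he⟩ := hns
  refine ⟨-e, irreducibleBinaryForm_of_forall_ne fun r hr => ?_⟩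
  have hr0 : r ≠ 0 := by rintro rfl; simp at hr
  apply he r⁻¹
  field_simp
  linear_combination hr

end BinaryForm

/-! ### The elliptic form -/

section EllipticForm

variable {F : Type*} [Field F] {d : F}

theorem polar_ellipticForm (d : F) (v w : Fin 6 → F) :
    QuadraticMap.polar (ellipticForm d) v w = 2 * d * v 0 * w 0 + v 0 * w 1 + v 1 * w 0
      + 2 * v 1 * w 1 + v 2 * w 3 + v 3 * w 2 + v 4 * w 5 + v 5 * w 4 := by
  simp only [QuadraticMap.polar, ellipticForm_apply, Pi.add_apply]
  ring

theorem eq_zero_of_polar_ellipticForm (hd : IrreducibleBinaryForm d) (v : Fin 6 → F)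
    (h : ∀ w, QuadraticMap.polar (ellipticForm d) v w = 0) : v = 0 := by
  have h' := fun i => h (Pi.single i 1)
  simp only [polar_ellipticForm] at h'
  have h0 := h' 0
  have h1 := h' 1
  have h2 := h' 2
  have h3 := h' 3
  have h4 := h' 4
  have h5 := h' 5
  simp at h0 h1 h2 h3 h4 h5
  have h01 : v 0 = 0 ∧ v 1 = 0 := by
    -- In characteristic 2 the polar form of the binary part is `v₀w₁ + v₁w₀`, visibly
    -- nondegenerate. Otherwise `v₀ h0 + v₁ h1` is twice the binary form at `v`, and anisotropy
    -- applies.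
    by_cases hc : (2 : F) = 0
    · simp only [hc, zero_mul, zero_add, add_zero] at h0 h1
      exact ⟨h1, h0⟩
    · refine hd.anisotropic (mul_left_cancel₀ hc ?_)
      linear_combination v 0 * h0 + v 1 * h1
  ext i
  fin_cases i <;> simp [h01, h2, h3, h4, h5]

theorem finrank_le_two_of_coordinates {n : ℕ} (W : Submodule F (Fin n → F)) (i j : Fin n)
    (h : ∀ w ∈ W, w i = 0 → w j = 0 → w = 0) : Module.finrank F W ≤ 2 := by
  let f : W →ₗ[F] F × F := ((LinearMap.proj i).prod (LinearMap.proj j)).comp W.subtype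
  have hf : Function.Injective f := by
    rw [← LinearMap.ker_eq_bot, LinearMap.ker_eq_bot']
    rintro ⟨w, hw⟩ h0
    exact Subtype.ext (h w hw (congrArg Prod.fst h0) (congrArg Prod.snd h0))
  simpa using LinearMap.finrank_le_finrank_of_injective hf

/-- Project `W` to the coordinates `(2, 4)`. On the kernel the binary part vanishes by anisotropy,
so kernel vectors live in the coordinates 3 and 5, and the polar form pairs them with the image.
When kernel and image are both nonzero, this pairing makes each one-dimensional. -/
theorem finrank_le_two_of_ellipticForm_eq_zero (hd : IrreducibleBinaryForm d)
    (W : Submodule F (Fin 6 → F)) (hW : ∀ w ∈ W, ellipticForm d w = 0) :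
    Module.finrank F W ≤ 2 := by
  have hpol : ∀ v ∈ W, ∀ w ∈ W, QuadraticMap.polar (ellipticForm d) v w = 0 := fun v hv w hw => by
    simp [QuadraticMap.polar, hW _ (add_mem hv hw), hW _ hv, hW _ hw]
  have hQ : ∀ w ∈ W, w 2 = 0 → w 4 = 0 → w 0 = 0 ∧ w 1 = 0 := fun w hw h2 h4 => by
    have := hW w hw
    rw [ellipticForm_apply, h2, h4] at this
    exact hd.anisotropic (by linear_combination this)
  have hext : ∀ w ∈ W, w 2 = 0 → w 4 = 0 → w 3 = 0 → w 5 = 0 → w = 0 := fun w hw h2 h4 h3 h5 => by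
    ext i
    have := hQ w hw h2 h4
    fin_cases i <;> simp [*]
  have hpol' : ∀ z ∈ W, ∀ w ∈ W, w 2 = 0 → w 4 = 0 → z 2 * w 3 + z 4 * w 5 = 0 :=
    fun z hz w hw h2 h4 => by
      have := hpol z hz w hw
      rw [polar_ellipticForm, (hQ w hw h2 h4).1, (hQ w hw h2 h4).2, h2, h4] at this
      linear_combination this
  by_cases h1 : ∀ w ∈ W, w 2 = 0 → w 4 = 0 → w = 0
  · exact finrank_le_two_of_coordinates W 2 4 h1
  by_cases h2 : ∀ w ∈ W, w 2 = 0 ∧ w 4 = 0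
  · exact finrank_le_two_of_coordinates W 3 5 fun w hw => hext w hw (h2 w hw).1 (h2 w hw).2
  push Not at h1 h2
  obtain ⟨k, hk, hk2, hk4, hk0⟩ := h1
  obtain ⟨z, hz, hz0⟩ := h2
  have hk35 : k 3 ≠ 0 ∨ k 5 ≠ 0 := by
    by_contra! h
    exact hk0 (hext k hk hk2 hk4 h.1 h.2)
  have hzk := hpol' z hz k hk hk2 hk4
  rcases hk35 with h3 | h5
  · refine finrank_le_two_of_coordinates W 4 3 fun w hw h4 h3' => ?_
    have hw2 : w 2 = 0 := by
      have := hpol' w hw k hk hk2 hk4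
      rw [h4] at this
      simpa [h3] using this
    have := hpol' z hz w hw hw2 h4
    have hz4 : z 4 ≠ 0 := fun h => by
      have h' : z 2 ≠ 0 := fun h' => hz0 h' h
      simp [h, h', h3] at hzk
    exact hext w hw hw2 h4 h3' (by simpa [h3', hz4] using this)
  · refine finrank_le_two_of_coordinates W 2 5 fun w hw hw2 h5' => ?_
    have h4 : w 4 = 0 := by
      have := hpol' w hw k hk hk2 hk4
      rw [hw2] at this
      simpa [h5] using this
    have := hpol' z hz w hw hw2 h4
    have hz2 : z 2 ≠ 0 := fun h => by
      simp [h, hz0 h, h5] at hzk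
    exact hext w hw hw2 h4 (by simpa [h5', hz2] using this) h5'

end EllipticForm

/-! ### The number of zeros -/

section Counting

open Classical in
-- For given `t`, each `a ≠ 0` admits exactly one `b`, while `a = 0` admits every `b` or none
-- according to whether `f t = 0`. The additive form avoids subtraction in `ℕ`.
theorem card_add_mul_eq_zero {F T : Type*} [Field F] [Fintype F] [Fintype T] (f : T → F) :
    Fintype.card {x : T × F × F // f x.1 + x.2.1 * x.2.2 = 0} + Fintype.card T
      = Fintype.card F * Fintype.card T + Fintype.card F * Fintype.card {t // f t = 0} := by
  have hb : ∀ t a, (∑ b : F, if f t + a * b = 0 then 1 else 0)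
      = if a = 0 then (if f t = 0 then Fintype.card F else 0) else 1 := fun t a => by
    split_ifs with ha h0
    · simp [ha, h0]
    · simp [ha, h0]
    · rw [Finset.sum_eq_single (-f t / a)]
      · rw [if_pos (by field_simp; ring)]
      · intro b _ hb
        rw [if_neg]
        intro h
        apply hb
        field_simp
        linear_combination h
      · simp
  have ha : ∀ t, (∑ a : F, if a = 0 then (if f t = 0 then Fintype.card F else 0) else 1) + 1
      = Fintype.card F + (if f t = 0 then Fintype.card F else 0) := fun t => by
    rw [← Finset.add_sum_erase _ _ (Finset.mem_univ (0 : F)), if_pos rfl,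
      Finset.sum_congr rfl (g := fun _ => 1) fun a ha => if_neg (Finset.ne_of_mem_erase ha)]
    simp only [Finset.sum_const, smul_eq_mul, mul_one, Finset.card_erase_of_mem (Finset.mem_univ _),
      Finset.card_univ]
    have := Fintype.card_pos (α := F)
    omega
  rw [Fintype.card_subtype, Finset.card_filter, Fintype.sum_prod_type]
  simp only [Fintype.sum_prod_type, hb]
  have : Fintype.card T = ∑ _t : T, 1 := by simp
  rw [this, ← Finset.sum_add_distrib, Finset.sum_congr rfl fun t _ => ha t,
    Finset.sum_add_distrib, ← Finset.sum_filter, Finset.sum_const, Finset.sum_const,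
    Fintype.card_subtype]
  simp [mul_comm]

theorem card_ellipticForm_eq_zero {F : Type*} [Field F] [Finite F] {d : F}
    (hd : IrreducibleBinaryForm d) :
    Nat.card {v : Fin 6 → F // ellipticForm d v = 0} + Nat.card F ^ 3
      = Nat.card F ^ 5 + Nat.card F ^ 2 := by
  classical
  have := Fintype.ofFinite F
  let f₀ : F × F → F := fun x => d * x.1 ^ 2 + x.1 * x.2 + x.2 ^ 2
  let f₁ : (F × F) × F × F → F := fun x => f₀ x.1 + x.2.1 * x.2.2
  have e : {v : Fin 6 → F // ellipticForm d v = 0}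
      ≃ {x : ((F × F) × F × F) × F × F // f₁ x.1 + x.2.1 * x.2.2 = 0} :=
    { toFun := fun v => ⟨(((v.1 0, v.1 1), v.1 2, v.1 3), v.1 4, v.1 5), by
        have := v.2
        rwa [ellipticForm_apply] at this⟩
      invFun := fun x => ⟨![x.1.1.1.1, x.1.1.1.2, x.1.1.2.1, x.1.1.2.2, x.1.2.1, x.1.2.2], by
        rw [ellipticForm_apply]
        exact x.2⟩
      left_inv := fun v => by
        ext i
        fin_cases i <;> rfl
      right_inv := fun x => rfl }
  have h0 : Fintype.card {x // f₀ x = 0} = 1 := by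
    rw [Fintype.card_eq_one_iff]
    refine ⟨⟨(0, 0), by simp [f₀]⟩, fun ⟨x, hx⟩ => ?_⟩
    have := hd.anisotropic hx
    exact Subtype.ext (Prod.ext this.1 this.2)
  have h1 : Fintype.card {x // f₁ x = 0} + _ = _ := card_add_mul_eq_zero f₀
  have h2 := card_add_mul_eq_zero f₁
  rw [Nat.card_congr e, Nat.card_eq_fintype_card, Nat.card_eq_fintype_card]
  rw [h0] at h1
  simp only [Fintype.card_prod] at h1 h2
  zify at h1 h2 ⊢
  linear_combination h2 + (Fintype.card F : ℤ) * h1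

/-- If `u` is not orthogonal to `x`, then `Q` is a non-constant affine function along `u + F x`, so
this coset has exactly one singular vector. Hence `q⁵ - q⁴` singular vectors lie off the hyperplane
orthogonal to `x`; the rest are counted here. -/
theorem card_ellipticForm_eq_zero_polar_eq_zero {F : Type*} [Field F] [Finite F] {d : F}
    (hd : IrreducibleBinaryForm d) {x : Fin 6 → F} (hx : x ≠ 0) (hQ : ellipticForm d x = 0) :
    Nat.card {v : Fin 6 → F // ellipticForm d v = 0 ∧ QuadraticMap.polar (ellipticForm d) x v = 0}
      + Nat.card F ^ 3 = Nat.card F ^ 4 + Nat.card F ^ 2 := by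
  classical
  have := Fintype.ofFinite F
  set Q := ellipticForm d
  let f : (Fin 6 → F) →ₗ[F] F := Q.polarBilin x
  have hf : ∀ v, f v = QuadraticMap.polar Q x v := fun v => rfl
  have hker : Nat.card {v // f v = 0} = Nat.card F ^ 5 := by
    have h1 : f ≠ 0 := fun h => hx (eq_zero_of_polar_ellipticForm hd x fun w => by
      rw [← hf, h]; rfl)
    have h2 := LinearMap.finrank_range_add_finrank_ker f
    have h3 : Module.finrank F (LinearMap.range f) = 1 := by
      rw [LinearMap.range_eq_top.2 (LinearMap.surjective h1)]
      simp
    simp [h3] at h2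
    have := Module.natCard_eq_pow_finrank (K := F) (V := LinearMap.ker f)
    rw [← show Module.finrank F (LinearMap.ker f) = 5 by omega, ← this]
    rfl
  have hall : Nat.card (Fin 6 → F) = Nat.card F ^ 6 := by
    rw [Nat.card_fun]; simp
  let e : {v // f v ≠ 0} ≃ {v : {v // Q v = 0} // f v.1 ≠ 0} × F :=
    { toFun := fun u => (⟨⟨u.1 - (Q u.1 / f u.1) • x, by
          have hu := u.2
          rw [sub_eq_add_neg, ← neg_smul, QuadraticMap.map_add ⇑Q, QuadraticMap.map_smul, hQ,
            QuadraticMap.polar_smul_right, QuadraticMap.polar_comm, ← hf]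
          simp [hu]⟩, by
          have : f x = 0 := by rw [hf, QuadraticMap.polar_self, hQ]; simp
          simpa [this] using u.2⟩, Q u.1 / f u.1)
      invFun := fun v => ⟨v.1.1.1 + v.2 • x, by
          have : f x = 0 := by rw [hf, QuadraticMap.polar_self, hQ]; simp
          simpa [this] using v.1.2⟩
      left_inv := fun u => by simp
      right_inv := fun v => by
        obtain ⟨⟨⟨v, hv⟩, hfv⟩, s⟩ := v
        have h0 : f x = 0 := by rw [hf, QuadraticMap.polar_self, hQ]; simp
        have : Q (v + s • x) / f (v + s • x) = s := by
          rw [QuadraticMap.map_add ⇑Q, QuadraticMap.map_smul, hQ, hv,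
            QuadraticMap.polar_smul_right, QuadraticMap.polar_comm, ← hf]
          simp at hfv
          simp [h0]
          field_simp
        have h1 : v + s • x - (Q (v + s • x) / f (v + s • x)) • x = v := by rw [this]; simp
        exact Prod.ext (Subtype.ext (Subtype.ext h1)) this }
  have he := Nat.card_congr e
  rw [Nat.card_prod] at he
  have hs1 := Nat.card_congr (Equiv.sumCompl fun v : Fin 6 → F => f v = 0)
  have hs2 := Nat.card_congr (Equiv.sumCompl fun v : {v : Fin 6 → F // Q v = 0} => f v.1 = 0)
  rw [Nat.card_sum] at hs1 hs2
  have hZ := card_ellipticForm_eq_zero hd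
  have hfin := Nat.card_congr (Equiv.subtypeSubtypeEquivSubtypeInter
    (fun v : Fin 6 → F => Q v = 0) (fun v => f v = 0))
  change Nat.card {v : Fin 6 → F // Q v = 0 ∧ f v = 0} + _ = _
  rw [← hfin]
  have hq : 0 < Nat.card F := Nat.card_pos
  -- The bijection `e` gives `q` times the number of singular vectors off the hyperplane, hence the
  -- factor `q`.
  apply Nat.eq_of_mul_eq_mul_left hq
  change Nat.card {v : Fin 6 → F // Q v = 0} + _ = _ at hZ
  change _ + Nat.card {v : Fin 6 → F // f v ≠ 0} = _ at hs1
  change _ + Nat.card {v : {v : Fin 6 → F // Q v = 0} // f v.1 ≠ 0} = _ at hs2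
  zify at *
  linear_combination (Nat.card F : ℤ) * hs2 + (Nat.card F : ℤ) * hZ - hs1 + he + hker - hall

end Counting

/-! ### Totally singular subspaces and hyperbolic frames -/

section QuadraticSpace

open QuadraticMap Module

variable {F V : Type*} [Field F] [AddCommGroup V] [Module F V] {Q : QuadraticForm F V}

theorem QuadraticMap.apply_smul_add_smul (Q : QuadraticForm F V) (s t : F) (a b : V) :
    Q (s • a + t • b) = s * s * Q a + t * t * Q b + s * t * polar Q a b := by
  rw [QuadraticMap.map_add ⇑Q, QuadraticMap.map_smul, QuadraticMap.map_smul, polar_smul_left,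
    polar_smul_right]
  simp [mul_assoc]

theorem QuadraticMap.polar_eq_zero_of_forall_mem {W : Submodule F V} (hW : ∀ w ∈ W, Q w = 0)
    {v w : V} (hv : v ∈ W) (hw : w ∈ W) : polar Q v w = 0 := by
  simp [polar, hW _ (add_mem hv hw), hW _ hv, hW _ hw]

theorem QuadraticMap.eq_zero_of_mem_span_pair {a b : V} (ha : Q a = 0) (hb : Q b = 0)
    (hab : polar Q a b = 0) : ∀ w ∈ Submodule.span F {a, b}, Q w = 0 := by
  intro w hw
  obtain ⟨s, t, rfl⟩ := Submodule.mem_span_pair.1 hw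
  simp [apply_smul_add_smul, ha, hb, hab]

theorem QuadraticMap.polar_eq_zero_of_mem_span_pair {a b p : V} (ha : polar Q p a = 0)
    (hb : polar Q p b = 0) : ∀ w ∈ Submodule.span F {a, b}, polar Q p w = 0 := by
  intro w hw
  obtain ⟨s, t, rfl⟩ := Submodule.mem_span_pair.1 hw
  simp [ha, hb, polar_add_right, polar_smul_right]

theorem Submodule.exists_span_pair_of_finrank_eq_two {L : Submodule F V} (h : finrank F L = 2) :
    ∃ a b, LinearIndependent F ![a, b] ∧ Submodule.span F {a, b} = L := by
  have : FiniteDimensional F L := Module.finite_of_finrank_pos (by omega)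
  let e := finBasisOfFinrankEq F L h
  have h1 : (![(e 0 : V), e 1] : Fin 2 → V) = L.subtype ∘ e := by
    ext i; fin_cases i <;> rfl
  have h2 : ({(e 0 : V), (e 1 : V)} : Set V) = Set.range (L.subtype ∘ e) := by
    rw [← h1, Matrix.range_cons_cons_empty]
  refine ⟨e 0, e 1, ?_, ?_⟩
  · rw [h1]
    exact e.linearIndependent.map' _ (Submodule.ker_subtype L)
  · rw [h2, Set.range_comp, Submodule.span_image, e.span_eq, Submodule.map_top,
      Submodule.range_subtype]

theorem finrank_span_pair_eq_two {a b : V} (h : LinearIndependent F ![a, b]) :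
    finrank F (Submodule.span F {a, b}) = 2 := by
  have := finrank_span_eq_card h
  rwa [Matrix.range_cons_cons_empty, Fintype.card_fin] at this

theorem Submodule.span_pair_eq {L : Submodule F V} (h : finrank F L = 2) {a b : V}
    (hab : LinearIndependent F ![a, b]) (ha : a ∈ L) (hb : b ∈ L) :
    Submodule.span F {a, b} = L := by
  have : FiniteDimensional F L := Module.finite_of_finrank_pos (by omega)
  refine Submodule.eq_of_le_of_finrank_le (Submodule.span_le.2 ?_) ?_
  · rintro x (rfl | rfl) <;> assumption
  · rw [h, finrank_span_pair_eq_two hab]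

/-- If totally singular subspaces have dimension at most two, then a singular vector orthogonal to
a two-dimensional totally singular subspace belongs to it. -/
theorem QuadraticMap.mem_of_polar_eq_zero [FiniteDimensional F V]
    (hI : ∀ W : Submodule F V, (∀ w ∈ W, Q w = 0) → finrank F W ≤ 2)
    {L : Submodule F V} (hL : finrank F L = 2) (hQL : ∀ w ∈ L, Q w = 0) {p : V} (hp : Q p = 0)
    (h : ∀ w ∈ L, polar Q p w = 0) : p ∈ L := by
  have hM := hI (L ⊔ Submodule.span F {p}) fun w hw => by
    obtain ⟨y, hy, z, hz, rfl⟩ := Submodule.mem_sup.1 hw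
    obtain ⟨t, rfl⟩ := Submodule.mem_span_singleton.1 hz
    rw [QuadraticMap.map_add ⇑Q, QuadraticMap.map_smul, polar_smul_right, polar_comm, hQL y hy, hp,
      h y hy]
    simp
  rw [Submodule.eq_of_le_of_finrank_le (le_sup_left : L ≤ L ⊔ Submodule.span F {p}) (by omega)]
  exact Submodule.mem_sup_right (Submodule.mem_span_singleton_self p)

theorem QuadraticMap.polarBilin_nondegenerate (hN : ∀ v, (∀ w, polar Q v w = 0) → v = 0) :
    LinearMap.BilinForm.Nondegenerate (polarBilin Q) :=
  ⟨hN, fun v h => hN v fun w => by rw [polar_comm]; exact h w⟩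

/-- Prescribed values on independent vectors extend to a linear functional, and nondegeneracy
represents it by a vector. -/
theorem QuadraticMap.exists_polar_eq [FiniteDimensional F V]
    (hN : ∀ v, (∀ w, polar Q v w = 0) → v = 0) {ι : Type*} {b : ι → V}
    (hb : LinearIndependent F b) (c : ι → F) : ∃ w, ∀ i, polar Q (b i) w = c i := by
  obtain ⟨f, hf⟩ := (((Basis.span hb).constr F) c).exists_extend
  refine ⟨(LinearMap.BilinForm.toDual _ (polarBilin_nondegenerate hN)).symm f, fun i => ?_⟩
  have h := LinearMap.BilinForm.apply_toDual_symm_apply (hB := polarBilin_nondegenerate hN) f (b i)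
  rw [polar_comm]
  refine h.trans ?_
  have := LinearMap.congr_fun hf (Basis.span hb i)
  rw [Basis.constr_basis] at this
  simpa [Basis.span_apply] using this

/-- Four vectors on whose combinations `Q` takes the values of the hyperbolic form. -/
def IsHyperbolicFrame (Q : QuadraticForm F V) (e : Fin 4 → V) : Prop :=
  Q.comp (Fintype.linearCombination F e) = hyperbolicForm F

theorem hyperbolicForm_apply (x : Fin 4 → F) : hyperbolicForm F x = x 0 * x 1 + x 2 * x 3 := by
  simp [hyperbolicForm]

theorem eq_zero_of_polar_hyperbolicForm (v : Fin 4 → F)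
    (h : ∀ w, polar (hyperbolicForm F) v w = 0) : v = 0 := by
  have h' := fun i => h (Pi.single i 1)
  simp only [polar, hyperbolicForm_apply] at h'
  have h0 := h' 0
  have h1 := h' 1
  have h2 := h' 2
  have h3 := h' 3
  simp [mul_add, add_mul] at h0 h1 h2 h3
  ext i
  fin_cases i <;> simp [*]

theorem linearCombination_fin_four (e : Fin 4 → V) (x : Fin 4 → F) :
    Fintype.linearCombination F e x = x 0 • e 0 + x 1 • e 1 + x 2 • e 2 + x 3 • e 3 := by
  simp [Fintype.linearCombination_apply, Fin.sum_univ_four]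

namespace IsHyperbolicFrame

variable {e : Fin 4 → V}

/-- A linear relation among the `e i` would lie in the radical of the hyperbolic form, which is
zero. -/
theorem injective (he : IsHyperbolicFrame Q e) :
    Function.Injective (Fintype.linearCombination F e) := by
  rw [← LinearMap.ker_eq_bot, LinearMap.ker_eq_bot']
  intro v hv
  refine eq_zero_of_polar_hyperbolicForm v fun w => ?_
  rw [← he]
  simp [polar, hv]

theorem finrank_range (he : IsHyperbolicFrame Q e) :
    finrank F (LinearMap.range (Fintype.linearCombination F e)) = 4 := by
  rw [LinearMap.finrank_range_of_inj he.injective]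
  simp

theorem equivalent (he : IsHyperbolicFrame Q e) :
    (Q.comp (LinearMap.range (Fintype.linearCombination F e)).subtype).Equivalent
      (hyperbolicForm F) := by
  refine QuadraticMap.Equivalent.symm ⟨⟨LinearEquiv.ofInjective _ he.injective, fun m => ?_⟩⟩
  rw [← he]
  rfl

end IsHyperbolicFrame

theorem isHyperbolicFrame_of_polar {e : Fin 4 → V} (hQ : ∀ i, Q (e i) = 0)
    (h01 : polar Q (e 0) (e 1) = 1) (h02 : polar Q (e 0) (e 2) = 0) (h03 : polar Q (e 0) (e 3) = 0)
    (h12 : polar Q (e 1) (e 2) = 0) (h13 : polar Q (e 1) (e 3) = 0)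
    (h23 : polar Q (e 2) (e 3) = 1) : IsHyperbolicFrame Q e := by
  ext x
  simp only [QuadraticMap.comp_apply, linearCombination_fin_four, hyperbolicForm_apply,
    QuadraticMap.map_add ⇑Q, QuadraticMap.map_smul, polar_add_left, polar_smul_left,
    polar_smul_right, hQ, h01, h02, h03, h12, h13, h23, smul_eq_mul]
  ring

theorem linearIndependent_fin_three_iff {a b c : V} : LinearIndependent F ![a, b, c] ↔
    ∀ s t u : F, s • a + t • b + u • c = 0 → s = 0 ∧ t = 0 ∧ u = 0 := by
  rw [Fintype.linearIndependent_iff]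
  simp only [Fin.sum_univ_three, Matrix.cons_val, Fin.forall_fin_succ]
  constructor
  · intro h s t u hs
    simpa using h ![s, t, u] (by simpa using hs)
  · intro h g hg
    simpa using h _ _ _ hg

theorem exists_isHyperbolicFrame [FiniteDimensional F V]
    (hN : ∀ v, (∀ w, polar Q v w = 0) → v = 0) {a b : V} (hab : LinearIndependent F ![a, b])
    (hQa : Q a = 0) (hQb : Q b = 0) (hpab : polar Q a b = 0) :
    ∃ e : Fin 4 → V, IsHyperbolicFrame Q e ∧ e 0 = a ∧ e 2 = b := by
  have haa : polar Q a a = 0 := by simp [polar_self, hQa]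
  have hbb : polar Q b b = 0 := by simp [polar_self, hQb]
  have hpba : polar Q b a = 0 := by rw [polar_comm, hpab]
  obtain ⟨c₀, hc₀⟩ := exists_polar_eq hN hab ![1, 0]
  have hc0 : polar Q a c₀ = 1 := hc₀ 0
  have hc1 : polar Q b c₀ = 0 := hc₀ 1
  -- Adding `s • a` to `c₀` changes `Q` by `s` and leaves both polar values unchanged, since `a` is
  -- singular and orthogonal to `b`. The vector `d` below is corrected in the same way by a multiple
  -- of `b`.
  obtain ⟨c, hac, hbc, hQc⟩ : ∃ c, polar Q a c = 1 ∧ polar Q b c = 0 ∧ Q c = 0 := by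
    refine ⟨c₀ + (-Q c₀) • a, ?_, ?_, ?_⟩
    · simp [polar_add_right, polar_smul_right, haa, hc0]
    · simp [polar_add_right, polar_smul_right, hpba, hc1]
    · rw [QuadraticMap.map_add ⇑Q, QuadraticMap.map_smul, polar_smul_right, polar_comm, hc0, hQa]
      simp
  have habc : LinearIndependent F ![a, b, c] := by
    rw [linearIndependent_fin_three_iff]
    intro s t u h
    have hu : u = 0 := by
      have := congrArg (polar Q a) h
      simpa [polar_add_right, polar_smul_right, haa, hpab, hac] using this
    rw [hu, zero_smul, add_zero] at h
    have := LinearIndependent.pair_iff.1 hab s t h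
    exact ⟨this.1, this.2, hu⟩
  obtain ⟨d₀, hd₀⟩ := exists_polar_eq hN habc ![0, 1, 0]
  have hd0 : polar Q a d₀ = 0 := hd₀ 0
  have hd1 : polar Q b d₀ = 1 := hd₀ 1
  have hd2 : polar Q c d₀ = 0 := hd₀ 2
  have hcb : polar Q c b = 0 := by rw [polar_comm, hbc]
  obtain ⟨d, had, hbd, hcd, hQd⟩ :
      ∃ d, polar Q a d = 0 ∧ polar Q b d = 1 ∧ polar Q c d = 0 ∧ Q d = 0 := by
    refine ⟨d₀ + (-Q d₀) • b, ?_, ?_, ?_, ?_⟩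
    · simp [polar_add_right, polar_smul_right, hpab, hd0]
    · simp [polar_add_right, polar_smul_right, hbb, hd1]
    · simp [polar_add_right, polar_smul_right, hcb, hd2]
    · rw [QuadraticMap.map_add ⇑Q, QuadraticMap.map_smul, polar_smul_right, polar_comm, hd1, hQb]
      simp
  refine ⟨![a, c, b, d], isHyperbolicFrame_of_polar ?_ hac hpab had hcb hcd hbd, rfl, rfl⟩
  intro i
  fin_cases i <;> assumption

/-- A second hyperbolic frame such that the spaces spanned by both frames meet in the given
two-dimensional totally singular subspace. -/
theorem IsHyperbolicFrame.exists_range_inf_range [FiniteDimensional F V]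
    (hN : ∀ v, (∀ w, polar Q v w = 0) → v = 0) (hdim : finrank F V = 6) {e : Fin 4 → V}
    (he : IsHyperbolicFrame Q e) :
    ∃ e' : Fin 4 → V, IsHyperbolicFrame Q e' ∧
      LinearMap.range (Fintype.linearCombination F e) ⊓
        LinearMap.range (Fintype.linearCombination F e') = Submodule.span F {e 0, e 2} := by
  set W := LinearMap.range (Fintype.linearCombination F e)
  have heW : ∀ i, e i ∈ W := fun i => ⟨Pi.single i 1, by simp⟩
  have hp : ∀ i j, polar Q (e i) (e j) =
      polar (hyperbolicForm F) (Pi.single i 1) (Pi.single j 1) := fun i j => by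
    rw [← he]
    simp [polar]
  have hQe : ∀ i, Q (e i) = 0 := fun i => by
    have : Q (e i) = hyperbolicForm F (Pi.single i 1) := by rw [← he]; simp
    rw [this, hyperbolicForm_apply]
    fin_cases i <;> simp
  have hrank := LinearMap.BilinForm.finrank_orthogonal (polarBilin_nondegenerate hN) W
  rw [he.finrank_range, hdim] at hrank
  obtain ⟨f, g, hfg, hspan⟩ := Submodule.exists_span_pair_of_finrank_eq_two hrank
  have hfW : ∀ i, polar Q (e i) f = 0 := fun i => by
    have : f ∈ LinearMap.BilinForm.orthogonal (polarBilin Q) W :=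
      hspan ▸ Submodule.subset_span (by simp)
    exact this _ (heW i)
  have hgW : ∀ i, polar Q (e i) g = 0 := fun i => by
    have : g ∈ LinearMap.BilinForm.orthogonal (polarBilin Q) W :=
      hspan ▸ Submodule.subset_span (by simp)
    exact this _ (heW i)
  have hfe : ∀ i, polar Q f (e i) = 0 := fun i => by rw [polar_comm, hfW]
  have hge : ∀ i, polar Q g (e i) = 0 := fun i => by rw [polar_comm, hgW]
  -- The form is nondegenerate on `W`, so `W` meets its orthogonal complement, spanned by `f` and
  -- `g`, only in 0.
  have hdisj : ∀ u v : F, u • f + v • g ∈ W → u = 0 ∧ v = 0 := fun u v h => by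
    obtain ⟨x, hx⟩ := h
    have hx0 : x = 0 := eq_zero_of_polar_hyperbolicForm x fun w => by
      have : polar (hyperbolicForm F) x w = polar Q (u • f + v • g)
          (Fintype.linearCombination F e w) := by
        rw [← hx, ← he]
        simp [polar]
      rw [this, linearCombination_fin_four]
      simp [polar_add_left, polar_add_right, polar_smul_left, polar_smul_right, hfe, hge]
    rw [hx0, map_zero] at hx
    exact LinearIndependent.pair_iff.1 hfg u v hx.symm
  -- Tilt `e 1` and `e 3` out of `W` by `f` and `g`, keeping `e 0` and `e 2`. The multiples of `e 0`
  -- and `e 2` restore `Q c = 0`, `Q d = 0` and the orthogonality of `c` and `d`.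
  let c := e 1 + f + (-Q f) • e 0
  let d := e 3 + g + (-polar Q f g) • e 0 + (-Q g) • e 2
  have hp' : ∀ i j, polar Q (e i) (e j) = (hyperbolicForm F (Pi.single i 1 + Pi.single j 1) -
      hyperbolicForm F (Pi.single i 1) - hyperbolicForm F (Pi.single j 1)) := hp
  simp only [hyperbolicForm_apply] at hp'
  have p00 : polar Q (e 0) (e 0) = 0 := by simp [polar_self, hQe]
  have p22 : polar Q (e 2) (e 2) = 0 := by simp [polar_self, hQe]
  have p01 := hp' 0 1
  have p02 := hp' 0 2
  have p03 := hp' 0 3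
  have p10 := hp' 1 0
  have p12 := hp' 1 2
  have p13 := hp' 1 3
  have p20 := hp' 2 0
  have p23 := hp' 2 3
  have p30 := hp' 3 0
  have p32 := hp' 3 2
  simp at p01 p02 p03 p10 p12 p13 p20 p23 p30 p32
  refine ⟨![e 0, c, e 2, d], ?_, ?_⟩
  · refine isHyperbolicFrame_of_polar ?_ ?_ ?_ ?_ ?_ ?_ ?_
    · intro i
      fin_cases i
      · exact hQe 0
      · change Q c = 0
        simp only [c, QuadraticMap.map_add ⇑Q, QuadraticMap.map_smul, polar_add_left,
          polar_smul_right, hQe, p10, hfe, hfW, smul_eq_mul]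
        ring
      · exact hQe 2
      · change Q d = 0
        simp only [d, QuadraticMap.map_add ⇑Q, QuadraticMap.map_smul, polar_add_left,
          polar_smul_left, polar_smul_right, hQe, p30, p32, p02, hge, hgW, smul_eq_mul]
        ring
    · change polar Q (e 0) c = 1
      simp only [c, polar_add_right, polar_smul_right, p01, p00, hfW, smul_eq_mul]
      ring
    · exact p02
    · change polar Q (e 0) d = 0
      simp only [d, polar_add_right, polar_smul_right, p03, p00, p02, hgW, smul_eq_mul]
      ring
    · change polar Q c (e 2) = 0
      simp only [c, polar_add_left, polar_smul_left, p12, p02, hfe, smul_eq_mul]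
      ring
    · change polar Q c d = 0
      simp only [c, d, polar_add_left, polar_smul_left, polar_add_right, polar_smul_right, p10, p12,
        p13, p00, p02, p03, hfe, hgW, smul_eq_mul]
      ring
    · change polar Q (e 2) d = 1
      simp only [d, polar_add_right, polar_smul_right, p23, p20, p22, hgW, smul_eq_mul]
      ring
  · apply le_antisymm
    · rintro w ⟨hw, x, rfl⟩
      rw [linearCombination_fin_four] at hw ⊢
      simp only [Matrix.cons_val] at hw ⊢
      have h : x 1 • f + x 3 • g ∈ W := by
        have hm : x 0 • e 0 + x 1 • (e 1 + (-Q f) • e 0) + x 2 • e 2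
            + x 3 • (e 3 + (-polar Q f g) • e 0 + (-Q g) • e 2) ∈ W := by
          have hs : ∀ (s : F) i, s • e i ∈ W := fun s i => W.smul_mem s (heW i)
          exact add_mem (add_mem (add_mem (hs _ _) (W.smul_mem _ (add_mem (heW _) (hs _ _))))
            (hs _ _)) (W.smul_mem _ (add_mem (add_mem (heW _) (hs _ _)) (hs _ _)))
        convert sub_mem hw hm using 1
        simp only [c, d]
        module
      obtain ⟨h1, h3⟩ := hdisj _ _ h
      rw [h1, h3]
      exact Submodule.mem_span_pair.2 ⟨x 0, x 2, by simp⟩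
    · rw [Submodule.span_le]
      rintro w (rfl | rfl)
      · exact ⟨heW 0, Pi.single 0 1, by simp⟩
      · exact ⟨heW 2, Pi.single 2 1, by simp⟩

/-- The singular vectors in the span of `a` and `b` are the multiples of `a` and of `b`, as `Q (s •
a + t • b) = s t · polar Q a b`; `c` is orthogonal to neither, so it is not among them. -/
theorem linearIndependent_of_polar_ne_zero {a b c : V} (ha : Q a = 0) (hb : Q b = 0)
    (hc : Q c = 0) (hab : polar Q a b ≠ 0) (hac : polar Q a c ≠ 0) (hbc : polar Q b c ≠ 0) :
    LinearIndependent F ![a, b, c] := by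
  have haa : polar Q a a = 0 := by simp [polar_self, ha]
  have hbb : polar Q b b = 0 := by simp [polar_self, hb]
  have hba : polar Q b a ≠ 0 := by rwa [polar_comm]
  rw [linearIndependent_fin_three_iff]
  intro s t u h
  have h1 := congrArg (polar Q a) h
  have h2 := congrArg (polar Q b) h
  simp only [polar_add_right, polar_smul_right, haa, hbb, smul_eq_mul, mul_zero, zero_add,
    add_zero, polar_zero_right] at h1 h2
  have h3 : s * t = 0 := by
    have h4 : Q (s • a + t • b) = 0 := by
      rw [eq_neg_of_add_eq_zero_left h, QuadraticMap.map_neg, QuadraticMap.map_smul, hc, smul_zero]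
    simpa [apply_smul_add_smul, ha, hb, hab] using h4
  rcases mul_eq_zero.1 h3 with rfl | rfl
  · have hu : u = 0 := by simpa [hbc] using h2
    exact ⟨rfl, by simpa [hu, hab] using h1, hu⟩
  · have hu : u = 0 := by simpa [hac] using h1
    exact ⟨by simpa [hu, hba] using h2, rfl, hu⟩

end QuadraticSpace

/-! ### Counting through fibres -/

theorem Nat.card_eq_mul_of_card_fiber {α β : Type*} [Finite α] [Finite β] (f : α → β) (k : ℕ)
    (h : ∀ b, Nat.card {a // f a = b} = k) : Nat.card α = Nat.card β * k := by
  have := Fintype.ofFinite β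
  rw [← Nat.card_congr (Equiv.sigmaFiberEquiv f), Nat.card_sigma]
  simp [h]

theorem Projectivization.card_mul_card_sub_one {F V : Type*} [Field F] [AddCommGroup V]
    [Module F V] [Finite F] [Finite V] (A : Set (ℙ F V)) :
    Nat.card {v : V // ∃ hv : v ≠ 0, Projectivization.mk F v hv ∈ A}
      = Nat.card A * (Nat.card F - 1) := by
  have : Finite (ℙ F V) := Quotient.finite _
  refine Nat.card_eq_mul_of_card_fiber (fun v => ⟨Projectivization.mk F v.1 v.2.1, v.2.2⟩) _ ?_
  rintro ⟨p, hp⟩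
  have e : Fˣ ≃ {a : {v : V // ∃ hv : v ≠ 0, Projectivization.mk F v hv ∈ A} //
      (⟨Projectivization.mk F a.1 a.2.1, a.2.2⟩ : A) = ⟨p, hp⟩} := by
    have h0 : ∀ a : Fˣ, a • p.rep ≠ 0 := fun a => (smul_ne_zero_iff_ne a).2 p.rep_nonzero
    have h1 : ∀ a : Fˣ, Projectivization.mk F (a • p.rep) (h0 a) = p := fun a => by
      conv_rhs => rw [← p.mk_rep]
      exact (Projectivization.mk_eq_mk_iff F _ _ _ _).2 ⟨a, rfl⟩
    refine Equiv.ofBijective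
      (fun a => ⟨⟨a • p.rep, h0 a, (h1 a).symm ▸ hp⟩, Subtype.ext (h1 a)⟩) ⟨?_, ?_⟩
    · intro a b hab
      have hab : a • p.rep = b • p.rep := congrArg (fun v => v.1.1) hab
      exact Units.ext (smul_left_injective F p.rep_nonzero hab)
    · rintro ⟨⟨v, hv, hvA⟩, h⟩
      have h : Projectivization.mk F v hv = p := congrArg Subtype.val h
      conv_rhs at h => rw [← p.mk_rep]
      obtain ⟨a, ha⟩ := (Projectivization.mk_eq_mk_iff F _ _ _ _).1 h
      exact ⟨a, Subtype.ext (Subtype.ext ha)⟩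
  rw [← Nat.card_congr e, Nat.card_units]

/-! ### Points and lines of the elliptic quadric -/

theorem Projectivization.Subspace.mem_iff_rep_mem {F V : Type*} [Field F] [AddCommGroup V]
    [Module F V] (W : Projectivization.Subspace F V) (p : ℙ F V) :
    p ∈ W ↔ p.rep ∈ Projectivization.Subspace.submodule W := by
  rw [Projectivization.Subspace.mem_submodule_iff W p.rep_nonzero, Projectivization.mk_rep]

namespace EllipticQuadric

open QuadraticMap Module

variable {F : Type*} [Field F] {d : F}

/-- The two-dimensional vector space belonging to a line of the quadric. -/
def lineSubmodule (l : Line d) : Submodule F (Fin 6 → F) :=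
  Projectivization.Subspace.submodule l.1

theorem inc_iff (p : Point d) (l : Line d) : Inc d p l ↔ p.1.rep ∈ lineSubmodule l :=
  Projectivization.Subspace.mem_iff_rep_mem _ _

theorem finrank_lineSubmodule (l : Line d) : finrank F (lineSubmodule l) = 2 := l.2.1

theorem ellipticForm_rep (p : Point d) : ellipticForm d p.1.rep = 0 := p.2

theorem ellipticForm_of_mem (l : Line d) : ∀ w ∈ lineSubmodule l, ellipticForm d w = 0 := by
  intro w hw
  rcases eq_or_ne w 0 with rfl | h0
  · exact QuadraticMap.map_zero _
  · exact (mk_mem_quadric _ w h0).1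
      (l.2.2 ((Projectivization.Subspace.mem_submodule_iff _ h0).1 hw))

theorem lineSubmodule_injective : Function.Injective (lineSubmodule (d := d)) := fun _ _ h =>
  Subtype.ext (Projectivization.Subspace.submodule.injective h)

theorem exists_lineSubmodule_eq (W : Submodule F (Fin 6 → F)) (h : finrank F W = 2)
    (hQ : ∀ w ∈ W, ellipticForm d w = 0) : ∃ l : Line d, lineSubmodule l = W := by
  refine ⟨⟨Projectivization.Subspace.submodule.symm W, ?_, ?_⟩, ?_⟩
  · rw [HasProjDim, OrderIso.apply_symm_apply, h]
  · intro p hp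
    apply hQ
    rwa [SetLike.mem_coe, Projectivization.Subspace.mem_iff_rep_mem,
      OrderIso.apply_symm_apply] at hp
  · exact OrderIso.apply_symm_apply _ _

theorem exists_point {v : Fin 6 → F} (hv : v ≠ 0) (hQ : ellipticForm d v = 0) :
    ∃ p : Point d, ∃ a : Fˣ, p.1.rep = a • v := by
  obtain ⟨a, ha⟩ := Projectivization.exists_smul_eq_mk_rep F v hv
  exact ⟨⟨Projectivization.mk F v hv, (mk_mem_quadric _ v hv).2 hQ⟩, a, ha.symm⟩

theorem linearIndependent_rep {p p' : Point d} (h : p ≠ p') :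
    LinearIndependent F ![p.1.rep, p'.1.rep] :=
  Projectivization.linearIndependent_pair_iff_ne.2 fun h' => h (Subtype.ext h')

/-- Two points of the quadric are orthogonal if their representatives are. -/
def Perp (p p' : Point d) : Prop := polar (ellipticForm d) p.1.rep p'.1.rep = 0

theorem Perp.symm {p p' : Point d} (h : Perp p p') : Perp p' p := by
  rw [Perp, polar_comm]; exact h

theorem perp_self (p : Point d) : Perp p p := by
  simp [Perp, polar_self, ellipticForm_rep p]

theorem perp_of_inc {p p' : Point d} {l : Line d} (h : Inc d p l) (h' : Inc d p' l) :
    Perp p p' :=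
  polar_eq_zero_of_forall_mem (ellipticForm_of_mem l) ((inc_iff _ _).1 h) ((inc_iff _ _).1 h')

theorem exists_line_of_perp {p p' : Point d} (hne : p ≠ p') (h : Perp p p') :
    ∃ l : Line d, Inc d p l ∧ Inc d p' l := by
  obtain ⟨l, hl⟩ := exists_lineSubmodule_eq (Submodule.span F {p.1.rep, p'.1.rep})
    (finrank_span_pair_eq_two (linearIndependent_rep hne))
    (eq_zero_of_mem_span_pair (ellipticForm_rep p) (ellipticForm_rep p') h)
  refine ⟨l, ?_, ?_⟩ <;> rw [inc_iff, hl] <;> exact Submodule.subset_span (by simp)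

theorem adj_iff (p p' : Point d) : (adjacencyGraph (Inc d)).Adj p p' ↔ p ≠ p' ∧ Perp p p' :=
  ⟨fun h => ⟨h.1, h.2.elim fun _ hl => perp_of_inc hl.1 hl.2⟩,
    fun h => ⟨h.1, exists_line_of_perp h.1 h.2⟩⟩

/-- The dictionary on which the code arguments rest: every point is orthogonal to itself, so the
closed neighbourhood needs no special case. -/
theorem mem_closedNbhd_iff (u c : Point d) :
    c ∈ (adjacencyGraph (Inc d)).closedNbhd u ↔ Perp u c := by
  rw [SimpleGraph.closedNbhd, Set.mem_insert_iff, SimpleGraph.mem_neighborSet, adj_iff]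
  by_cases h : c = u
  · simp [h, perp_self]
  · simp [h, Ne.symm h]

theorem span_rep_eq {p p' : Point d} (hne : p ≠ p') {l : Line d} (h : Inc d p l)
    (h' : Inc d p' l) : Submodule.span F {p.1.rep, p'.1.rep} = lineSubmodule l :=
  Submodule.span_pair_eq (finrank_lineSubmodule l) (linearIndependent_rep hne)
    ((inc_iff _ _).1 h) ((inc_iff _ _).1 h')

theorem inc_of_perp (hd : IrreducibleBinaryForm d) {p a b : Point d} {l : Line d} (hab : a ≠ b)
    (ha : Inc d a l) (hb : Inc d b l) (hpa : Perp p a) (hpb : Perp p b) : Inc d p l := by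
  rw [inc_iff]
  refine mem_of_polar_eq_zero (finrank_le_two_of_ellipticForm_eq_zero hd)
    (finrank_lineSubmodule l) (ellipticForm_of_mem l) (ellipticForm_rep p) ?_
  rw [← span_rep_eq hab ha hb]
  exact polar_eq_zero_of_mem_span_pair hpa hpb

theorem eq_of_perp (hd : IrreducibleBinaryForm d) {p a b : Point d} {l : Line d}
    (hp : ¬ Inc d p l) (ha : Inc d a l) (hb : Inc d b l) (hpa : Perp p a) (hpb : Perp p b) :
    a = b := by
  by_contra hab
  exact hp (inc_of_perp hd hab ha hb hpa hpb)

theorem exists_inc_perp (p : Point d) (l : Line d) : ∃ y, Inc d y l ∧ Perp p y := by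
  obtain ⟨a, b, hab, hl⟩ := Submodule.exists_span_pair_of_finrank_eq_two (finrank_lineSubmodule l)
  have ha : a ∈ lineSubmodule l := hl ▸ Submodule.subset_span (by simp)
  have hb : b ∈ lineSubmodule l := hl ▸ Submodule.subset_span (by simp)
  have key : ∃ w ∈ lineSubmodule l, w ≠ 0 ∧ polar (ellipticForm d) p.1.rep w = 0 := by
    by_cases h : polar (ellipticForm d) p.1.rep a = 0
    · exact ⟨a, ha, hab.ne_zero 0, h⟩
    -- The standard kernel vector of a functional on a plane: `B(p,b) a - B(p,a) b`.
    · refine ⟨polar (ellipticForm d) p.1.rep b • a + (-polar (ellipticForm d) p.1.rep a) • b,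
        add_mem (Submodule.smul_mem _ _ ha) (Submodule.smul_mem _ _ hb), fun h0 => h ?_, ?_⟩
      · simpa using (LinearIndependent.pair_iff.1 hab _ _ h0).2
      · simp only [polar_add_right, polar_smul_right, smul_eq_mul]
        ring
  obtain ⟨w, hw, hw0, hpw⟩ := key
  obtain ⟨y, c, hy⟩ := exists_point hw0 (ellipticForm_of_mem l w hw)
  refine ⟨y, ?_, ?_⟩
  · rw [inc_iff, hy]
    exact Submodule.smul_mem _ _ hw
  · rw [Perp, hy, Units.smul_def, polar_smul_right, hpw, smul_zero]

theorem line_eq {x y : Point d} (hxy : x ≠ y) {l m : Line d} (hxl : Inc d x l) (hyl : Inc d y l)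
    (hxm : Inc d x m) (hym : Inc d y m) : l = m :=
  lineSubmodule_injective (by rw [← span_rep_eq hxy hxl hyl, ← span_rep_eq hxy hxm hym])

theorem ncard_lineSubmodule (l : Line d) :
    (lineSubmodule l : Set (Fin 6 → F)).ncard = Nat.card F ^ 2 := by
  have := Module.natCard_eq_pow_finrank (K := F) (V := lineSubmodule l)
  rwa [finrank_lineSubmodule] at this

/-! ### Parameters of the quadrangle -/

section Counting

variable [Finite F]

theorem ncard_inc (l : Line d) : {x : Point d | Inc d x l}.ncard = Nat.card F + 1 := by
  have hF : 1 < Nat.card F := Finite.one_lt_card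
  have h := Projectivization.card_mul_card_sub_one {p : ℙ F (Fin 6 → F) | p ∈ l.1}
  have h1 : Nat.card {v : Fin 6 → F // ∃ hv : v ≠ 0, Projectivization.mk F v hv ∈
      {p : ℙ F (Fin 6 → F) | p ∈ l.1}} = Nat.card F ^ 2 - 1 := by
    rw [← ncard_lineSubmodule l, ← Set.ncard_sdiff_singleton_of_mem (zero_mem (lineSubmodule l))]
    refine Nat.card_congr (Equiv.subtypeEquivRight fun v => ?_)
    simp only [Set.mem_ofPred_eq, Set.mem_sdiff, SetLike.mem_coe, Set.mem_singleton_iff]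
    constructor
    · rintro ⟨hv, h⟩
      exact ⟨(Projectivization.Subspace.mem_submodule_iff _ hv).2 h, hv⟩
    · rintro ⟨h, hv⟩
      exact ⟨hv, (Projectivization.Subspace.mem_submodule_iff _ hv).1 h⟩
  have h2 : {x : Point d | Inc d x l}.ncard = Nat.card {p : ℙ F (Fin 6 → F) | p ∈ l.1} := by
    refine Nat.card_congr
      { toFun := fun x => ⟨x.1.1, x.2⟩
        invFun := fun p => ⟨⟨p.1, l.2.2 p.2⟩, p.2⟩
        left_inv := fun _ => rfl
        right_inv := fun _ => rfl }
  rw [h2]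
  rw [h1] at h
  apply Nat.eq_of_mul_eq_mul_right (show 0 < Nat.card F - 1 by omega)
  rw [← h]
  obtain ⟨k, hk⟩ : ∃ k, Nat.card F = k + 1 := ⟨Nat.card F - 1, by omega⟩
  rw [hk]
  simp only [Nat.add_sub_cancel]
  rw [Nat.sub_eq_iff_eq_add (Nat.pow_pos (by omega))]
  ring

theorem card_point (hd : IrreducibleBinaryForm d) :
    Nat.card (Point d) = (Nat.card F + 1) * (Nat.card F ^ 3 + 1) := by
  have hF : 1 < Nat.card F := Finite.one_lt_card
  have h := Projectivization.card_mul_card_sub_one (quadric (ellipticForm d))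
  have hZ := card_ellipticForm_eq_zero hd
  have h1 : Nat.card {v : Fin 6 → F // ∃ hv : v ≠ 0, Projectivization.mk F v hv ∈
      quadric (ellipticForm d)} + 1 = Nat.card {v : Fin 6 → F // ellipticForm d v = 0} := by
    have h0 : (0 : Fin 6 → F) ∈ {v | ellipticForm d v = 0} := QuadraticMap.map_zero _
    have := Set.ncard_sdiff_singleton_add_one h0
    refine Eq.trans ?_ this
    congr 1
    refine Nat.card_congr (Equiv.subtypeEquivRight fun v => ?_)
    simp only [mk_mem_quadric, Set.mem_sdiff, Set.mem_ofPred_eq, Set.mem_singleton_iff]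
    exact ⟨fun ⟨a, b⟩ => ⟨b, a⟩, fun ⟨a, b⟩ => ⟨b, a⟩⟩
  change Nat.card (quadric (ellipticForm d)) = _
  apply Nat.eq_of_mul_eq_mul_right (show 0 < Nat.card F - 1 by omega)
  rw [h] at h1
  obtain ⟨k, hk⟩ : ∃ k, Nat.card F = k + 1 := ⟨Nat.card F - 1, by omega⟩
  rw [hk] at h1 hZ ⊢
  simp only [Nat.add_sub_cancel] at h1 ⊢
  zify at *
  linear_combination h1 + hZ

theorem ncard_lines (hd : IrreducibleBinaryForm d) (x : Point d) :
    {l : Line d | Inc d x l}.ncard = Nat.card F ^ 2 + 1 := by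
  have hF : 1 < Nat.card F := Finite.one_lt_card
  have hfin : Finite (Projectivization.Subspace F (Fin 6 → F)) :=
    Finite.of_equiv _ Projectivization.Subspace.submodule.symm.toEquiv
  have hspan : ((Submodule.span F {x.1.rep} : Submodule F (Fin 6 → F)) : Set (Fin 6 → F)).ncard
      = Nat.card F := by
    have := Module.natCard_eq_pow_finrank (K := F) (V := Submodule.span F {x.1.rep})
    rwa [finrank_span_singleton x.1.rep_nonzero, pow_one] at this
  let A : Set (Fin 6 → F) := {v | ellipticForm d v = 0 ∧ polar (ellipticForm d) x.1.rep v = 0} \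
    ((Submodule.span F {x.1.rep} : Submodule F (Fin 6 → F)) : Set (Fin 6 → F))
  have hA : A.ncard + Nat.card F + Nat.card F ^ 3 = Nat.card F ^ 4 + Nat.card F ^ 2 := by
    rw [← card_ellipticForm_eq_zero_polar_eq_zero hd x.1.rep_nonzero (ellipticForm_rep x)]
    congr 1
    rw [← hspan]
    refine Set.ncard_sdiff_add_ncard_of_subset ?_
    intro v hv
    obtain ⟨t, rfl⟩ := Submodule.mem_span_singleton.1 hv
    have := perp_self x
    rw [Perp] at this
    simp [QuadraticMap.map_smul, ellipticForm_rep x, polar_smul_right, this]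
  have hli : ∀ v : A, LinearIndependent F ![x.1.rep, v.1] := fun v => by
    rw [LinearIndependent.pair_iff' x.1.rep_nonzero]
    intro a ha
    exact v.2.2 (Submodule.mem_span_singleton.2 ⟨a, ha⟩)
  have hex : ∀ v : A, ∃ l : Line d, lineSubmodule l = Submodule.span F {x.1.rep, v.1} := fun v =>
    exists_lineSubmodule_eq _ (finrank_span_pair_eq_two (hli v))
      (eq_zero_of_mem_span_pair (ellipticForm_rep x) v.2.1.1 v.2.1.2)
  choose f hf using hex
  have hfx : ∀ v, Inc d x (f v) := fun v => by
    rw [inc_iff, hf]; exact Submodule.subset_span (by simp)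
  -- Each vector of `A` spans with `x` one line through `x`, and each such line contains `q² - q`
  -- vectors of `A`. Since `|A| = q⁴ - q³ + q² - q = (q² + 1)(q² - q)`, there are `q² + 1` lines.
  have hcard := Nat.card_eq_mul_of_card_fiber
    (fun v : A => (⟨f v, hfx v⟩ : {l : Line d | Inc d x l})) (Nat.card F ^ 2 - Nat.card F) (by
      rintro ⟨l, hl⟩
      have hxl := (inc_iff _ _).1 hl
      rw [← ncard_lineSubmodule l, ← hspan, ← Set.ncard_sdiff (by
        simpa [Submodule.span_singleton_le_iff_mem] using hxl)]
      have hmem : ∀ v : A, f v = l ↔ v.1 ∈ lineSubmodule l := fun v => by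
        constructor
        · rintro rfl
          rw [hf]
          exact Submodule.subset_span (by simp)
        · intro hv
          apply lineSubmodule_injective
          rw [hf, Submodule.span_pair_eq (finrank_lineSubmodule l) (hli v) hxl hv]
      refine Nat.card_congr
        { toFun := fun v => ⟨v.1.1, (hmem _).1 (congrArg Subtype.val v.2), v.1.2.2⟩
          invFun := fun v => ⟨⟨v.1, ⟨⟨ellipticForm_of_mem l _ v.2.1, polar_eq_zero_of_forall_mem
            (ellipticForm_of_mem l) hxl v.2.1⟩, v.2.2⟩⟩, Subtype.ext ((hmem _).2 v.2.1)⟩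
          left_inv := fun _ => rfl
          right_inv := fun _ => rfl })
  have hcard : A.ncard = {l : Line d | Inc d x l}.ncard * (Nat.card F ^ 2 - Nat.card F) := hcard
  rw [hcard] at hA
  have h2 : Nat.card F ^ 2 - Nat.card F = Nat.card F * (Nat.card F - 1) := by
    rw [pow_two, Nat.mul_sub_one]
  rw [h2] at hA
  obtain ⟨k, hk⟩ : ∃ k, Nat.card F = k + 2 := ⟨Nat.card F - 2, by omega⟩
  rw [hk] at hA ⊢
  apply Nat.eq_of_mul_eq_mul_right (show 0 < (k + 2) * (k + 1) by positivity)
  rw [show k + 2 - 1 = k + 1 by omega] at hA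
  zify at *
  linear_combination hA

theorem isGeneralizedQuadrangle (hd : IrreducibleBinaryForm d) :
    IsGeneralizedQuadrangle (Inc d) (Nat.card F) (Nat.card F ^ 2) where
  pos_left := Nat.card_pos
  pos_right := pow_pos Nat.card_pos 2
  nonempty := by
    have : 0 < Nat.card (Point d) := by rw [card_point hd]; positivity
    exact (Nat.card_pos_iff.1 this).1
  line_unique := fun _ _ hxy _ _ => line_eq hxy
  card_points := ncard_inc
  card_lines := ncard_lines hd
  projection := fun x l hx => by
    obtain ⟨y, hy, hxy⟩ := exists_inc_perp x l
    have hne : ∀ z, Inc d z l → x ≠ z := fun z hz h => hx (h ▸ hz)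
    obtain ⟨m, hxm, hym⟩ := exists_line_of_perp (hne y hy) hxy
    refine ⟨m, ⟨hxm, y, hym, hy⟩, ?_⟩
    rintro m' ⟨hxm', y', hym', hy'⟩
    have hyy := eq_of_perp hd hx hy' hy (perp_of_inc hxm' hym') hxy
    subst hyy
    exact line_eq (hne _ hy') hxm' hym' hxm hym

end Counting

end EllipticQuadric

namespace Projectivization.Subspace

variable {F V : Type*} [Field F] [AddCommGroup V] [Module F V]

theorem mem_inf_iff (W W' : Subspace F V) (p : ℙ F V) : p ∈ W ⊓ W' ↔ p ∈ W ∧ p ∈ W' := Iff.rfl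

theorem submodule_inf (W W' : Subspace F V) :
    submodule (W ⊓ W') = submodule W ⊓ submodule W' := by
  ext v
  rcases eq_or_ne v 0 with rfl | hv
  · simp
  · rw [Submodule.mem_inf, mem_submodule_iff _ hv, mem_submodule_iff _ hv, mem_submodule_iff _ hv,
      mem_inf_iff]

end Projectivization.Subspace

namespace EllipticQuadric

open QuadraticMap Module

variable {F : Type*} [Field F] {d : F}

/-! ### Solids and lines in general position -/

theorem exists_isSolidPair (hd : IrreducibleBinaryForm d) (l₀ : Line d) :
    ∃ π₁ π₂, IsSolidPair d l₀ π₁ π₂ := by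
  obtain ⟨a, b, hab, hl⟩ := Submodule.exists_span_pair_of_finrank_eq_two (finrank_lineSubmodule l₀)
  have ha : a ∈ lineSubmodule l₀ := hl ▸ Submodule.subset_span (by simp)
  have hb : b ∈ lineSubmodule l₀ := hl ▸ Submodule.subset_span (by simp)
  have hN := eq_zero_of_polar_ellipticForm hd
  obtain ⟨e, he, rfl, rfl⟩ := exists_isHyperbolicFrame hN hab (ellipticForm_of_mem l₀ _ ha)
    (ellipticForm_of_mem l₀ _ hb) (polar_eq_zero_of_forall_mem (ellipticForm_of_mem l₀) ha hb)
  obtain ⟨e', he', hinf⟩ := he.exists_range_inf_range hN (by simp)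
  refine ⟨Projectivization.Subspace.submodule.symm (LinearMap.range (Fintype.linearCombination F e)),
    Projectivization.Subspace.submodule.symm (LinearMap.range (Fintype.linearCombination F e')),
    ?_, ?_, ?_, ?_, ?_⟩
  · rw [HasProjDim, OrderIso.apply_symm_apply, he.finrank_range]
  · rw [HasProjDim, OrderIso.apply_symm_apply, he'.finrank_range]
  · apply Projectivization.Subspace.submodule.injective
    rw [Projectivization.Subspace.submodule_inf, OrderIso.apply_symm_apply,
      OrderIso.apply_symm_apply, hinf, hl]
    rfl
  · rw [MeetsInHyperbolicQuadric, OrderIso.apply_symm_apply]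
    exact he.equivalent
  · rw [MeetsInHyperbolicQuadric, OrderIso.apply_symm_apply]
    exact he'.equivalent

theorem inf_eq_bot_of_lineSubmodule {l m : Line d} (h : lineSubmodule l ⊓ lineSubmodule m = ⊥) :
    l.1 ⊓ m.1 = ⊥ := by
  apply Projectivization.Subspace.submodule.injective
  rw [Projectivization.Subspace.submodule_inf, OrderIso.map_bot]
  exact h

theorem span_pair_inf_span_pair_eq_bot {V : Type*} [AddCommGroup V] [Module F V] {n : ℕ}
    {f : (Fin n → F) →ₗ[F] V} (hf : Function.Injective f) {x y x' y' : Fin n → F}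
    (h : ∀ s t s' t' : F, s • x + t • y = s' • x' + t' • y' → s = 0 ∧ t = 0) :
    Submodule.span F {f x, f y} ⊓ Submodule.span F {f x', f y'} = ⊥ := by
  rw [eq_bot_iff]
  rintro w ⟨hw, hw'⟩
  obtain ⟨s, t, rfl⟩ := Submodule.mem_span_pair.1 hw
  obtain ⟨s', t', hst⟩ := Submodule.mem_span_pair.1 hw'
  obtain ⟨rfl, rfl⟩ := h s t s' t' (hf (by simpa using hst.symm))
  simp

theorem exists_lines_of_meetsInHyperbolicQuadric {l₀ : Line d}
    {π : Projectivization.Subspace F (Fin 6 → F)} (hle : l₀.1 ≤ π)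
    (hπ : MeetsInHyperbolicQuadric (ellipticForm d) π) :
    ∃ l m : Line d, l.1 ≤ π ∧ m.1 ≤ π ∧ l₀.1 ⊓ l.1 = ⊥ ∧ l₀.1 ⊓ m.1 = ⊥ ∧ l.1 ⊓ m.1 = ⊥ := by
  set W := Projectivization.Subspace.submodule π
  have hN : ∀ v, (∀ w, polar ((ellipticForm d).comp W.subtype) v w = 0) → v = 0 := by
    obtain ⟨g⟩ := hπ
    intro v hv
    have : g v = 0 := eq_zero_of_polar_hyperbolicForm _ fun w => by
      obtain ⟨w, rfl⟩ := g.toLinearEquiv.surjective w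
      have h1 := g.map_app (v + w)
      rw [show g (v + w) = g v + g w from map_add g.toLinearEquiv v w] at h1
      rw [← hv w, polar, polar, ← g.map_app v, ← g.map_app w]
      exact congrArg (fun t => t - _ - _) h1
    exact (LinearEquiv.map_eq_zero_iff g.toLinearEquiv).1 this
  obtain ⟨a, b, hab, hl⟩ := Submodule.exists_span_pair_of_finrank_eq_two (finrank_lineSubmodule l₀)
  have ha : a ∈ lineSubmodule l₀ := hl ▸ Submodule.subset_span (by simp)
  have hb : b ∈ lineSubmodule l₀ := hl ▸ Submodule.subset_span (by simp)
  have hl₀W : lineSubmodule l₀ ≤ W := Projectivization.Subspace.submodule.monotone hle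
  have hab' : LinearIndependent F ![(⟨a, hl₀W ha⟩ : W), ⟨b, hl₀W hb⟩] := by
    refine LinearIndependent.of_comp W.subtype ?_
    convert hab using 1
    ext i : 1
    fin_cases i <;> rfl
  obtain ⟨e, he, h0, h2⟩ := exists_isHyperbolicFrame hN hab' (ellipticForm_of_mem l₀ _ ha)
    (ellipticForm_of_mem l₀ _ hb) (polar_eq_zero_of_forall_mem (ellipticForm_of_mem l₀) ha hb)
  let f : (Fin 4 → F) →ₗ[F] (Fin 6 → F) := W.subtype.comp (Fintype.linearCombination F e)
  have hf : Function.Injective f := W.injective_subtype.comp he.injective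
  have hfQ : ∀ x, ellipticForm d (f x) = x 0 * x 1 + x 2 * x 3 := fun x => by
    rw [← hyperbolicForm_apply, ← he]
    rfl
  have hline : ∀ x y : Fin 4 → F, (∀ s t : F, s • x + t • y = 0 → s = 0 ∧ t = 0) →
      (∀ s t : F, hyperbolicForm F (s • x + t • y) = 0) →
      ∃ l : Line d, l.1 ≤ π ∧ lineSubmodule l = Submodule.span F {f x, f y} := by
    intro x y hxy hQ
    have hli : LinearIndependent F ![f x, f y] := LinearIndependent.pair_iff.2 fun s t h =>
      hxy s t (hf (by simpa using h))
    obtain ⟨l, hl⟩ := exists_lineSubmodule_eq (d := d) (Submodule.span F {f x, f y})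
      (finrank_span_pair_eq_two hli) (fun w hw => by
        obtain ⟨s, t, rfl⟩ := Submodule.mem_span_pair.1 hw
        rw [← map_smul, ← map_smul, ← map_add, hfQ, ← hyperbolicForm_apply, hQ])
    refine ⟨l, Projectivization.Subspace.submodule.le_iff_le.1 ?_, hl⟩
    change lineSubmodule l ≤ W
    rw [hl, Submodule.span_le]
    rintro w (rfl | rfl) <;> exact Submodule.coe_mem _
  have hl₀ : lineSubmodule l₀ = Submodule.span F {f ![1, 0, 0, 0], f ![0, 0, 1, 0]} := by
    rw [← hl]
    simp [f, linearCombination_fin_four, h0, h2]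
  obtain ⟨l, hlπ, hl⟩ := hline ![0, 1, 0, 0] ![0, 0, 0, 1]
    (by simp) (by simp [hyperbolicForm_apply])
  -- In the frame, `l₀` is spanned by `e 0, e 2` and `l` by `e 1, e 3`. The third line, spanned by
  -- `e 0 + e 3` and `e 2 - e 1`, belongs to the same regulus and exists even for `q = 2`.
  obtain ⟨m, hmπ, hm⟩ := hline ![1, 0, 0, 1] ![0, -1, 1, 0]
    (by simp +contextual) (by simp [hyperbolicForm_apply, mul_comm])
  refine ⟨l, m, hlπ, hmπ, inf_eq_bot_of_lineSubmodule ?_, inf_eq_bot_of_lineSubmodule ?_,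
    inf_eq_bot_of_lineSubmodule ?_⟩
  · rw [hl₀, hl]
    exact span_pair_inf_span_pair_eq_bot hf (by simp +contextual)
  · rw [hl₀, hm]
    refine span_pair_inf_span_pair_eq_bot hf fun s t s' t' h => ?_
    simp at h
    simp [h]
  · rw [hl, hm]
    refine span_pair_inf_span_pair_eq_bot hf fun s t s' t' h => ?_
    simp at h
    obtain ⟨h1, h2, h3, h4⟩ := h
    simp [h2, h4, ← h1, ← h3]

theorem IsSolidPair.le_left {l₀ : Line d} {π₁ π₂ : Projectivization.Subspace F (Fin 6 → F)}
    (h : IsSolidPair d l₀ π₁ π₂) : l₀.1 ≤ π₁ := by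
  rw [← h.inf_eq]
  exact fun _ hp => hp.1

theorem IsSolidPair.le_right {l₀ : Line d} {π₁ π₂ : Projectivization.Subspace F (Fin 6 → F)}
    (h : IsSolidPair d l₀ π₁ π₂) : l₀.1 ≤ π₂ := by
  rw [← h.inf_eq]
  exact fun _ hp => hp.2

theorem IsSolidPair.exists_isFiveLines {l₀ : Line d}
    {π₁ π₂ : Projectivization.Subspace F (Fin 6 → F)} (h : IsSolidPair d l₀ π₁ π₂) :
    ∃ l : Fin 5 → Line d, l 0 = l₀ ∧ IsFiveLines d π₁ π₂ l := by
  obtain ⟨l₁, l₂, h₁, h₂, h₀₁, h₀₂, h₁₂⟩ := exists_lines_of_meetsInHyperbolicQuadric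
    h.le_left h.hyperbolic_left
  obtain ⟨l₃, l₄, h₃, h₄, h₀₃, h₀₄, h₃₄⟩ := exists_lines_of_meetsInHyperbolicQuadric
    h.le_right h.hyperbolic_right
  exact ⟨![l₀, l₁, l₂, l₃, l₄], rfl, h, h₁, h₂, h₃, h₄, h₀₁, h₀₂, h₁₂, h₀₃, h₀₄, h₃₄⟩

/-! ### Points with the same projections -/

theorem mem_of_perp (hd : IrreducibleBinaryForm d) {p a b : Point d} (hab : a ≠ b)
    {W : Projectivization.Subspace F (Fin 6 → F)} (ha : a.1 ∈ W) (hb : b.1 ∈ W)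
    (h : Perp a b) (hpa : Perp p a) (hpb : Perp p b) : p.1 ∈ W := by
  obtain ⟨m, ham, hbm⟩ := exists_line_of_perp hab h
  have hp := inc_of_perp hd hab ham hbm hpa hpb
  rw [inc_iff, ← span_rep_eq hab ham hbm] at hp
  rw [Projectivization.Subspace.mem_iff_rep_mem] at *
  refine Submodule.span_le.2 ?_ hp
  rintro x (rfl | rfl) <;> assumption

/-- All of `u`, `v`, `z` are forced onto the line `ab`: first `u` and `v`, being orthogonal to `a`
and `b`, then `z`, being orthogonal to `u` and `v`. -/
theorem mem_of_perp_of_perp (hd : IrreducibleBinaryForm d) {u v a b z : Point d} (huv : u ≠ v)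
    (hab : a ≠ b) {W : Projectivization.Subspace F (Fin 6 → F)} (ha : a.1 ∈ W) (hb : b.1 ∈ W)
    (h : Perp a b) (hua : Perp u a) (hub : Perp u b) (hva : Perp v a) (hvb : Perp v b)
    (hu : Perp u z) (hv : Perp v z) : z.1 ∈ W := by
  obtain ⟨m, ham, hbm⟩ := exists_line_of_perp hab h
  have hum := inc_of_perp hd hab ham hbm hua hub
  have hvm := inc_of_perp hd hab ham hbm hva hvb
  have hzm := inc_of_perp hd huv hum hvm hu.symm hv.symm
  exact mem_of_perp hd hab ha hb h (perp_of_inc hzm ham) (perp_of_inc hzm hbm)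

namespace IsFiveLines

variable {π₁ π₂ : Projectivization.Subspace F (Fin 6 → F)} {l : Fin 5 → Line d}

theorem inc_zero (h : IsFiveLines d π₁ π₂ l) {p : Point d} (h₁ : p.1 ∈ π₁) (h₂ : p.1 ∈ π₂) :
    Inc d p (l 0) := by
  rw [Inc, ← h.solids.inf_eq]
  exact ⟨h₁, h₂⟩

theorem eq_of_inc (h : IsFiveLines d π₁ π₂ l) {i j : Fin 5} {p : Point d} (hi : Inc d p (l i))
    (hj : Inc d p (l j)) : i = j := by
  have key : ∀ {i j}, (l i).1 ⊓ (l j).1 = ⊥ → Inc d p (l i) → ¬ Inc d p (l j) := by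
    intro i j hij hi hj
    have hp : p.1 ∈ (l i).1 ⊓ (l j).1 := ⟨hi, hj⟩
    rw [hij, ← SetLike.mem_coe, Projectivization.Subspace.bot_coe] at hp
    exact hp
  -- A common point of a line in `π₁` and a line in `π₂` lies on `l 0`, which is disjoint from the
  -- former.
  have cross : ∀ {i j}, (l i).1 ≤ π₁ → (l j).1 ≤ π₂ → (l 0).1 ⊓ (l i).1 = ⊥ →
      Inc d p (l i) → ¬ Inc d p (l j) := fun hi hj h0 hpi hpj =>
    key h0 (h.inc_zero (hi hpi) (hj hpj)) hpi
  have c13 := cross h.le₁ h.le₃ h.inf₀₁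
  have c14 := cross h.le₁ h.le₄ h.inf₀₁
  have c23 := cross h.le₂ h.le₃ h.inf₀₂
  have c24 := cross h.le₂ h.le₄ h.inf₀₂
  have c01 := key h.inf₀₁
  have c02 := key h.inf₀₂
  have c03 := key h.inf₀₃
  have c04 := key h.inf₀₄
  have c12 := key h.inf₁₂
  have c34 := key h.inf₃₄
  have hlt : ∀ i j : Fin 5, i < j → Inc d p (l i) → ¬ Inc d p (l j) := by
    intro i j hij
    fin_cases i <;> fin_cases j <;> first
      | exact absurd hij (by decide)
      | exact c01
      | exact c02
      | exact c03
      | exact c04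
      | exact c12
      | exact c13
      | exact c14
      | exact c23
      | exact c24
      | exact c34
  rcases lt_trichotomy i j with hij | hij | hij
  · exact absurd hj (hlt i j hij hi)
  · exact hij
  · exact absurd hi (hlt j i hij hj)

theorem eq_of_forall_perp (hd : IrreducibleBinaryForm d) (h : IsFiveLines d π₁ π₂ l)
    {u v : Point d} (hul : ¬ Inc d u (l 0)) {y : Fin 5 → Point d} (hy : ∀ i, Inc d (y i) (l i))
    (hu : ∀ i, Perp u (y i)) (hv : ∀ i, Perp v (y i)) : u = v := by
  by_contra huv
  have hne : ∀ i j, i ≠ j → y i ≠ y j := fun i j hij hyij =>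
    hij (h.eq_of_inc (hy i) (hyij ▸ hy j))
  -- If two of the projections in `π₁` were orthogonal, `y 3` would lie in `π₁` as well, hence on `l
  -- 0`, which is disjoint from `l 3`. For `π₂` the point `y 1` plays this role.
  have h1 : ∀ i j, i ≠ j → (y i).1 ∈ π₁ → (y j).1 ∈ π₁ → ¬ Perp (y i) (y j) := by
    intro i j hij hi hj hp
    have h3 := mem_of_perp_of_perp hd huv (hne i j hij) hi hj hp (hu i) (hu j) (hv i) (hv j)
      (hu 3) (hv 3)
    exact absurd (h.eq_of_inc (h.inc_zero h3 (h.le₃ (hy 3))) (hy 3)) (by decide)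
  have h2 : ∀ i j, i ≠ j → (y i).1 ∈ π₂ → (y j).1 ∈ π₂ → ¬ Perp (y i) (y j) := by
    intro i j hij hi hj hp
    have h3 := mem_of_perp_of_perp hd huv (hne i j hij) hi hj hp (hu i) (hu j) (hv i) (hv j)
      (hu 1) (hv 1)
    exact absurd (h.eq_of_inc (h.inc_zero (h.le₁ (hy 1)) h3) (hy 1)) (by decide)
  have hN := polarBilin_nondegenerate (eq_zero_of_polar_ellipticForm hd)
  let O := LinearMap.BilinForm.orthogonal (polarBilin (ellipticForm d))
    (Submodule.span F {u.1.rep, v.1.rep})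
  have huv2 : finrank F (Submodule.span F {u.1.rep, v.1.rep}) = 2 :=
    finrank_span_pair_eq_two (linearIndependent_rep huv)
  have hO : finrank F O = 4 := by
    rw [LinearMap.BilinForm.finrank_orthogonal hN, huv2, finrank_fin_fun]
  have hyO : ∀ i, (y i).1.rep ∈ O := fun i => by
    intro n hn
    have := polar_eq_zero_of_mem_span_pair (hu i).symm (hv i).symm n hn
    rwa [polar_comm] at this
  have plane : ∀ (i j k : Fin 5) (W : Projectivization.Subspace F (Fin 6 → F)),
      (y i).1 ∈ W → (y j).1 ∈ W → (y k).1 ∈ W → ¬ Perp (y i) (y j) → ¬ Perp (y i) (y k) →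
      ¬ Perp (y j) (y k) → ∃ A : Submodule F (Fin 6 → F), finrank F A = 3 ∧ A ≤ O ∧
        A ≤ Projectivization.Subspace.submodule W := by
    intro i j k W hi hj hk hij hik hjk
    rw [Projectivization.Subspace.mem_iff_rep_mem] at hi hj hk
    refine ⟨_, finrank_span_eq_card (linearIndependent_of_polar_ne_zero (ellipticForm_rep (y i))
      (ellipticForm_rep (y j)) (ellipticForm_rep (y k)) hij hik hjk), ?_, ?_⟩
    all_goals
      rw [Submodule.span_le, Set.range_subset_iff]
      intro m
      fin_cases m
    exacts [hyO i, hyO j, hyO k, hi, hj, hk]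
  obtain ⟨A, hA, hAO, hAπ⟩ := plane 0 1 2 π₁ (h.solids.le_left (hy 0)) (h.le₁ (hy 1)) (h.le₂ (hy 2))
    (h1 0 1 (by decide) (h.solids.le_left (hy 0)) (h.le₁ (hy 1)))
    (h1 0 2 (by decide) (h.solids.le_left (hy 0)) (h.le₂ (hy 2)))
    (h1 1 2 (by decide) (h.le₁ (hy 1)) (h.le₂ (hy 2)))
  obtain ⟨B, hB, hBO, hBπ⟩ := plane 0 3 4 π₂ (h.solids.le_right (hy 0)) (h.le₃ (hy 3)) (h.le₄ (hy 4))
    (h2 0 3 (by decide) (h.solids.le_right (hy 0)) (h.le₃ (hy 3)))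
    (h2 0 4 (by decide) (h.solids.le_right (hy 0)) (h.le₄ (hy 4)))
    (h2 3 4 (by decide) (h.le₃ (hy 3)) (h.le₄ (hy 4)))
  have hsup : finrank F ↥(A ⊔ B) ≤ 4 := hO ▸ Submodule.finrank_mono (sup_le hAO hBO)
  have hinf : finrank F ↥(A ⊓ B) ≤ finrank F ↥(lineSubmodule (l 0) ⊓ O) := by
    refine Submodule.finrank_mono (le_inf ?_ (inf_le_left.trans hAO))
    refine (inf_le_inf hAπ hBπ).trans ?_
    rw [← Projectivization.Subspace.submodule_inf, h.solids.inf_eq]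
    exact le_rfl
  -- As `u` is off `l 0`, it is not orthogonal to all of `l 0`, so `A ⊓ B` has dimension at most 1.
  -- But `3 + 3 - 4 = 2`.
  have hlt : lineSubmodule (l 0) ⊓ O < lineSubmodule (l 0) := by
    refine lt_of_le_of_ne inf_le_left fun heq => hul ?_
    rw [inc_iff]
    refine mem_of_polar_eq_zero (finrank_le_two_of_ellipticForm_eq_zero hd)
      (finrank_lineSubmodule _) (ellipticForm_of_mem _) (ellipticForm_rep u) fun w hw => ?_
    rw [← heq] at hw
    exact hw.2 _ (Submodule.subset_span (by simp))
  have := Submodule.finrank_lt_finrank_of_lt hlt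
  rw [finrank_lineSubmodule] at this
  have := Submodule.finrank_sup_add_finrank_inf_eq A B
  omega

end IsFiveLines

end EllipticQuadric

/-! ### The identifying codes -/

theorem SimpleGraph.IsIdentifyingCode.mono {V : Type*} {G : SimpleGraph V} {S T : Set V}
    (hS : G.IsIdentifyingCode S) (h : S ⊆ T) : G.IsIdentifyingCode T :=
  ⟨fun v => (hS.1 v).mono (Set.inter_subset_inter_left _ h),
    fun u v huv => (hS.2 u v huv).imp fun _ hc => ⟨h hc.1, hc.2⟩⟩

theorem Set.ncard_exists_mem {ι P : Type*} [Finite ι] [Finite P] {A : ι → Set P} {k : ℕ}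
    (hA : ∀ i, (A i).ncard = k) (hdisj : ∀ i j p, p ∈ A i → p ∈ A j → i = j) :
    {p | ∃ i, p ∈ A i}.ncard = Nat.card ι * k := by
  choose f hf using fun p : {p | ∃ i, p ∈ A i} => p.2
  refine Nat.card_eq_mul_of_card_fiber f k fun i => ?_
  rw [← hA i]
  exact Nat.card_congr
    { toFun := fun p => ⟨p.1.1, by have := hf p.1; rwa [p.2] at this⟩
      invFun := fun p => ⟨⟨p.1, i, p.2⟩, hdisj _ _ _ (hf _) p.2⟩
      left_inv := fun _ => rfl
      right_inv := fun _ => rfl }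

namespace EllipticQuadric

variable {F : Type*} [Field F] {d : F}

theorem separates_iff (c u v : Point d) :
    (adjacencyGraph (Inc d)).Separates c u v ↔ ¬ (Perp u c ↔ Perp v c) := by
  rw [SimpleGraph.Separates, Set.mem_symmDiff, mem_closedNbhd_iff, mem_closedNbhd_iff]
  tauto

namespace IsFiveLines

variable {π₁ π₂ : Projectivization.Subspace F (Fin 6 → F)} {l : Fin 5 → Line d}

/-- The removed points are the points of the five lines that are equal to or projections of `x`. -/
theorem exists_mem_diff_iff (hd : IrreducibleBinaryForm d) (h : IsFiveLines d π₁ π₂ l)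
    {x : Point d} (hx : Inc d x (l 0)) : ∃ y : Fin 5 → Point d, y 0 = x ∧
      (∀ i, Inc d (y i) (l i)) ∧ (∀ i, Perp x (y i)) ∧
      linePoints l \ removedPoints l x = {p | ∃ i, p ∈ {p | Inc d p (l i)} \ {y i}} := by
  choose z hz hxz using fun i => exists_inc_perp x (l i)
  obtain ⟨y, hy0, hy, hxy⟩ : ∃ y : Fin 5 → Point d, y 0 = x ∧ (∀ i, Inc d (y i) (l i)) ∧
      (∀ i, Perp x (y i)) := by
    refine ⟨Function.update z 0 x, by simp, fun i => ?_, fun i => ?_⟩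
    all_goals
      rcases eq_or_ne i 0 with rfl | hi
    · simpa using hx
    · simpa [hi] using hz i
    · simpa using perp_self x
    · simpa [hi] using hxz i
  refine ⟨y, hy0, hy, hxy, Set.ext fun p => ⟨?_, ?_⟩⟩
  · rintro ⟨⟨i, hi⟩, hr⟩
    refine ⟨i, hi, fun hp => hr ?_⟩
    rcases eq_or_ne i 0 with rfl | hi0
    · exact Or.inl (hp.trans hy0)
    · refine Or.inr ⟨i, hi0, hi, (adj_iff _ _).2 ⟨?_, ?_⟩⟩
      · rintro rfl
        exact hi0 (h.eq_of_inc hi hx)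
      · rw [show p = y i from hp]
        exact hxy i
  · rintro ⟨i, hi, hne⟩
    refine ⟨⟨i, hi⟩, ?_⟩
    rintro (rfl | ⟨j, hj0, hj, hadj⟩)
    · obtain rfl := h.eq_of_inc hi hx
      exact hne hy0.symm
    · obtain rfl := h.eq_of_inc hi hj
      exact hne (eq_of_perp hd (fun hxi => hj0 (h.eq_of_inc hxi hx)) hi (hy i)
        ((adj_iff _ _).1 hadj).2 (hxy i))

variable [Finite F]

theorem ncard_linePoints (h : IsFiveLines d π₁ π₂ l) :
    (linePoints l).ncard = 5 * Nat.card F + 5 := by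
  have := Set.ncard_exists_mem (A := fun i => {p : Point d | Inc d p (l i)})
    (fun i => ncard_inc (l i)) fun i j p hi hj => h.eq_of_inc hi hj
  refine this.trans ?_
  rw [Nat.card_fin, mul_add]

theorem ncard_linePoints_diff (hd : IrreducibleBinaryForm d) (h : IsFiveLines d π₁ π₂ l)
    {x : Point d} (hx : Inc d x (l 0)) :
    (linePoints l \ removedPoints l x).ncard = 5 * Nat.card F := by
  obtain ⟨y, -, hy, -, hS⟩ := h.exists_mem_diff_iff hd hx
  rw [hS, Set.ncard_exists_mem (k := Nat.card F) (fun i => ?_)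
    fun i j p hi hj => h.eq_of_inc hi.1 hj.1, Nat.card_fin]
  rw [Set.ncard_sdiff_singleton_of_mem (show y i ∈ {p | Inc d p (l i)} from hy i),
    ncard_inc, Nat.add_sub_cancel]

theorem isIdentifyingCode_diff (hd : IrreducibleBinaryForm d) (h : IsFiveLines d π₁ π₂ l)
    {x : Point d} (hx : Inc d x (l 0)) : (adjacencyGraph (Inc d)).IsIdentifyingCode
      (linePoints l \ removedPoints l x) := by
  obtain ⟨y, rfl, hy, hxy, hS⟩ := h.exists_mem_diff_iff hd hx
  -- Each line keeps `q ≥ 2` points, enough to determine it.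
  have hcard : ∀ i, 1 < ({p | Inc d p (l i)} \ {y i}).ncard := fun i => by
    rw [Set.ncard_sdiff_singleton_of_mem (show y i ∈ {p | Inc d p (l i)} from hy i),
      ncard_inc, Nat.add_sub_cancel]
    exact Finite.one_lt_card
  have hmem : ∀ {i p}, Inc d p (l i) → p ≠ y i → p ∈ linePoints l \ removedPoints l (y 0) :=
    fun {i p} hp hne => hS ▸ ⟨i, hp, hne⟩
  have hyne : ∀ i j, i ≠ j → y i ≠ y j := fun i j hij hyij =>
    hij (h.eq_of_inc (hy i) (hyij ▸ hy j))
  constructor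
  · intro v
    by_contra hv
    have hv' : ∀ i z, Inc d z (l i) → Perp v z → z = y i := fun i z hz hvz => by
      by_contra hne
      exact hv ⟨z, hmem hz hne, (mem_closedNbhd_iff _ _).2 hvz⟩
    have hvl : ∀ i, ¬ Inc d v (l i) := fun i hi => by
      obtain ⟨p, hp⟩ := Set.nonempty_of_ncard_ne_zero (hcard i).ne_bot
      exact hp.2 (hv' i p hp.1 (perp_of_inc hi hp.1))
    have hvy : ∀ i, Perp v (y i) := fun i => by
      obtain ⟨z, hz, hvz⟩ := exists_inc_perp v (l i)
      exact hv' i z hz hvz ▸ hvz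
    -- An undominated `v` has the deleted points as projections. Being orthogonal to `y 0` and `y
    -- 1`, which are themselves orthogonal, it lies on their line, inside `π₁`; `y 0` and `y 3` put
    -- it in `π₂`.
    refine hvl 0 (h.inc_zero ?_ ?_)
    · exact mem_of_perp hd (hyne 0 1 (by decide)) (h.solids.le_left (hy 0)) (h.le₁ (hy 1)) (hxy 1)
        (hvy 0) (hvy 1)
    · exact mem_of_perp hd (hyne 0 3 (by decide)) (h.solids.le_right (hy 0)) (h.le₃ (hy 3)) (hxy 3)
        (hvy 0) (hvy 3)
  · intro u v huv
    by_contra! hsep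
    have hsame : ∀ {i c}, Inc d c (l i) → c ≠ y i → (Perp u c ↔ Perp v c) := fun hc hne => by
      have := hsep _ (hmem hc hne)
      rwa [separates_iff, not_not] at this
    clear hsep
    -- If `u` is on `l i`, the remaining points of `l i` force `v` onto `l i` too. On another line
    -- `l j` the projections of `u` and `v` then differ, so one of them is still in the code, and it
    -- separates `u` from `v`.
    have off : ∀ {u v : Point d}, u ≠ v →
        (∀ {i c}, Inc d c (l i) → c ≠ y i → (Perp u c ↔ Perp v c)) → ∀ i, ¬ Inc d u (l i) := by
      intro u v huv hsame i hui
      obtain ⟨a, b, ha, hb, hab⟩ := (Set.one_lt_ncard_iff).1 (hcard i)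
      have hvi : Inc d v (l i) := inc_of_perp hd hab ha.1 hb.1
        ((hsame ha.1 ha.2).1 (perp_of_inc hui ha.1)) ((hsame hb.1 hb.2).1 (perp_of_inc hui hb.1))
      obtain ⟨j, hij⟩ := exists_ne i
      obtain ⟨s, hs, hus⟩ := exists_inc_perp u (l j)
      obtain ⟨t, ht, hvt⟩ := exists_inc_perp v (l j)
      have hst : s ≠ t := by
        rintro rfl
        exact hij (h.eq_of_inc hs (inc_of_perp hd huv hui hvi hus.symm hvt.symm))
      have huj : ¬ Inc d u (l j) := fun h' => hij (h.eq_of_inc h' hui)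
      have hvj : ¬ Inc d v (l j) := fun h' => hij (h.eq_of_inc h' hvi)
      by_cases hsy : s = y j
      · have hty : t ≠ y j := fun hty => hst (hsy.trans hty.symm)
        exact hst (eq_of_perp hd huj hs ht hus ((hsame ht hty).2 hvt))
      · exact hst (eq_of_perp hd hvj hs ht ((hsame hs hsy).1 hus) hvt)
    have hul := off huv hsame
    choose w hw huw using fun i => exists_inc_perp u (l i)
    refine huv (h.eq_of_forall_perp hd (hul 0) hw huw fun i => ?_)
    -- It remains to show that `v` is orthogonal to `w i`. This is immediate if `w i` is in the
    -- code; otherwise the projection `t` of `v` is either the same deleted point or a code point,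
    -- hence orthogonal to `u` and equal to `w i`.
    by_cases hwy : w i = y i
    · obtain ⟨t, ht, hvt⟩ := exists_inc_perp v (l i)
      by_cases hty : t = y i
      · rwa [hwy, ← hty]
      · rwa [eq_of_perp hd (hul i) (hw i) ht (huw i) ((hsame ht hty).2 hvt)]
    · exact (hsame (hw i) hwy).1 (huw i)

theorem isIdentifyingCode (hd : IrreducibleBinaryForm d) (h : IsFiveLines d π₁ π₂ l) :
    (adjacencyGraph (Inc d)).IsIdentifyingCode (linePoints l) := by
  have hne : {x : Point d | Inc d x (l 0)}.ncard ≠ 0 := by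
    rw [ncard_inc]
    exact Nat.succ_ne_zero _
  obtain ⟨x, hx⟩ := Set.nonempty_of_ncard_ne_zero hne
  exact (h.isIdentifyingCode_diff hd hx).mono Set.sdiff_subset

end IsFiveLines

/-! ### Comparison of `5q` with `n^{1/4}`: `q⁴ ≤ n = (q + 1)(q³ + 1) ≤ 4q⁴` -/

section Size

variable [Finite F]

theorem card_point_rpow_le (hd : IrreducibleBinaryForm d) :
    1 * (Nat.card (Point d) : ℝ) ^ (1 / 4 : ℝ) ≤ 5 * (Nat.card F : ℝ) := by
  have hq : (1 : ℝ) ≤ Nat.card F := by exact_mod_cast Nat.card_pos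
  have hq3 : (1 : ℝ) ≤ (Nat.card F : ℝ) ^ 3 := one_le_pow₀ hq
  rw [one_mul, one_div, Real.rpow_inv_le_iff_of_pos (by positivity) (by positivity) (by norm_num),
    card_point hd, show (4 : ℝ) = (4 : ℕ) by norm_num, Real.rpow_natCast]
  push_cast
  calc ((Nat.card F : ℝ) + 1) * ((Nat.card F : ℝ) ^ 3 + 1)
      ≤ (Nat.card F + Nat.card F) * ((Nat.card F : ℝ) ^ 3 + (Nat.card F : ℝ) ^ 3) := by gcongr
    _ = 4 * (Nat.card F : ℝ) ^ 4 := by ring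
    _ ≤ 5 ^ 4 * (Nat.card F : ℝ) ^ 4 := by gcongr; norm_num
    _ = (5 * (Nat.card F : ℝ)) ^ 4 := by ring

theorem le_card_point_rpow (hd : IrreducibleBinaryForm d) :
    5 * (Nat.card F : ℝ) ≤ 5 * (Nat.card (Point d) : ℝ) ^ (1 / 4 : ℝ) := by
  gcongr
  rw [one_div, Real.le_rpow_inv_iff_of_pos (by positivity) (by positivity) (by norm_num),
    card_point hd, show (4 : ℝ) = (4 : ℕ) by norm_num, Real.rpow_natCast]
  norm_cast
  calc Nat.card F ^ 4 = Nat.card F * Nat.card F ^ 3 := by ring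
    _ ≤ (Nat.card F + 1) * (Nat.card F ^ 3 + 1) := by gcongr <;> omega

end Size

end EllipticQuadric

theorem mainTheorem5 :
    ∃ c C : ℝ, 0 < c ∧ 0 < C ∧ ∀ q : ℕ, IsPrimePow q →
      (∃ (P L : Type) (I : P → L → Prop) (S : Set P),
        IsGeneralizedQuadrangle I q (q ^ 2) ∧
        (adjacencyGraph I).IsIdentifyingCode S ∧ S.ncard = 5 * q ∧
        c * (Nat.card P : ℝ) ^ (1 / 4 : ℝ) ≤ 5 * (q : ℝ) ∧
        5 * (q : ℝ) ≤ C * (Nat.card P : ℝ) ^ (1 / 4 : ℝ)) ∧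
      ∀ (F : Type*) [Field F], Nat.card F = q →
        (∃ d : F, IrreducibleBinaryForm d) ∧
        ∀ d : F, IrreducibleBinaryForm d →
          IsGeneralizedQuadrangle (EllipticQuadric.Inc d) q (q ^ 2) ∧
          c * (Nat.card (EllipticQuadric.Point d) : ℝ) ^ (1 / 4 : ℝ) ≤ 5 * (q : ℝ) ∧
          5 * (q : ℝ) ≤ C * (Nat.card (EllipticQuadric.Point d) : ℝ) ^ (1 / 4 : ℝ) ∧
          (∀ l₀ : EllipticQuadric.Line d, ∃ π₁ π₂, EllipticQuadric.IsSolidPair d l₀ π₁ π₂) ∧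
          (∀ (l₀ : EllipticQuadric.Line d) (π₁ π₂ : Projectivization.Subspace F (Fin 6 → F)),
            EllipticQuadric.IsSolidPair d l₀ π₁ π₂ →
            ∃ l : Fin 5 → EllipticQuadric.Line d,
              l 0 = l₀ ∧ EllipticQuadric.IsFiveLines d π₁ π₂ l) ∧
          (∀ (π₁ π₂ : Projectivization.Subspace F (Fin 6 → F))
            (l : Fin 5 → EllipticQuadric.Line d), EllipticQuadric.IsFiveLines d π₁ π₂ l →
            ((adjacencyGraph (EllipticQuadric.Inc d)).IsIdentifyingCode
                (EllipticQuadric.linePoints l) ∧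
              (EllipticQuadric.linePoints l).ncard = 5 * q + 5) ∧
            ∀ x : EllipticQuadric.Point d, EllipticQuadric.Inc d x (l 0) →
              (adjacencyGraph (EllipticQuadric.Inc d)).IsIdentifyingCode
                (EllipticQuadric.linePoints l \ EllipticQuadric.removedPoints l x) ∧
              (EllipticQuadric.linePoints l \ EllipticQuadric.removedPoints l x).ncard
                = 5 * q) := by
  refine ⟨1, 5, one_pos, by norm_num, fun q hq => ⟨?_, ?_⟩⟩
  · obtain ⟨p, k, hp, hk, rfl⟩ := hq
    have : Fact p.Prime := ⟨hp.nat_prime⟩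
    have hcard : Nat.card (GaloisField p k) = p ^ k := GaloisField.card p k hk.ne'
    obtain ⟨d, hd⟩ := exists_irreducibleBinaryForm (GaloisField p k)
    have hGQ := EllipticQuadric.isGeneralizedQuadrangle hd
    obtain ⟨p₀⟩ := hGQ.nonempty
    have hne : {l : EllipticQuadric.Line d | EllipticQuadric.Inc d p₀ l}.ncard ≠ 0 := by
      rw [hGQ.card_lines]
      exact Nat.succ_ne_zero _
    obtain ⟨l₀, hp₀⟩ := Set.nonempty_of_ncard_ne_zero hne
    obtain ⟨π₁, π₂, hπ⟩ := EllipticQuadric.exists_isSolidPair hd l₀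
    obtain ⟨l, rfl, hl⟩ := hπ.exists_isFiveLines
    rw [← hcard]
    exact ⟨_, _, _, _, hGQ, hl.isIdentifyingCode_diff hd hp₀, hl.ncard_linePoints_diff hd hp₀,
      EllipticQuadric.card_point_rpow_le hd, EllipticQuadric.le_card_point_rpow hd⟩
  · rintro F _ rfl
    have : Finite F := Nat.finite_of_card_ne_zero hq.pos.ne'
    exact ⟨exists_irreducibleBinaryForm F, fun d hd =>
      ⟨EllipticQuadric.isGeneralizedQuadrangle hd, EllipticQuadric.card_point_rpow_le hd,
        EllipticQuadric.le_card_point_rpow hd, EllipticQuadric.exists_isSolidPair hd,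
        fun _ _ _ h => h.exists_isFiveLines, fun _ _ _ h =>
          ⟨⟨h.isIdentifyingCode hd, h.ncard_linePoints⟩, fun _ hx =>
            ⟨h.isIdentifyingCode_diff hd hx, h.ncard_linePoints_diff hd hx⟩⟩⟩⟩
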